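/- Let $(W,S)$ be a Coxeter system with $S$ finite. A subset $T\subseteq S$ is spherical if the subgroup $W_T$ generated by $T$ is finite; the nerve $L$ of $(W,S)$ is the simplicial complex with vertex set $S$ whose simplices are the non-empty spherical subsets. The Davis complex $\Sigma$ is the geometric realization of the poset of all cosets $wW_T$ ($w\in W$, $T$ spherical) ordered by inclusion; its (closed Coxeter) cell of type $T$ belonging to $wW_T$ is the realization of the poset of such cosets contained in $wW_T$. For $U\subseteq S$ and a spherical $T\subseteq U$, let $\Omega(U,T)\subseteq\Sigma$ be the union of the closed cells whose type $T'$ satisfies $T\subseteq T'\subseteq U$, and let $\partial\Omega(U,T)$ be the union of the cells of $\Omega(U,T)$ whose type does not contain $T$; write $\Omega(U,t)$ for $\Omega(U,\{t\})$. Let $\mathcal H_i$ denote reduced $\ell^2$-homology (square-summable cycles modulo the closure of the boundaries of square-summable chains). For an integer $n\ge 0$ consider the following statements. - $\mathrm{II}(n)$: for every Coxeter system $(W,S)$ whose nerve is a triangulation of $\mathbb S^{n-1}$ and every $t\in S$, $\mathcal H_i(\Omega(S,t),\partial\Omega(S,t))=0$ for all $i>\frac n2$. - $\mathrm{TR}(n)$: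 for every Coxeter system $(W,S)$ whose nerve is a triangulation of $\mathbb S^{n-1}$, every $V\subseteq S$ and every spherical $T\subseteq V$ with exactly two elements, $\mathcal H_i(\Omega(V,T),\partial\Omega(V,T))=0$ for all $i>\frac n2+1$. - $\mathrm{V}(n)$: for every Coxeter system $(W,S)$ whose nerve is a triangulation of $\mathbb S^{n-1}$, every $V\subseteq S$ and every $t\in V$, $\mathcal H_i(\Omega(V,t),\partial\Omega(V,t))=0$ for all $i>\frac n2$. **Proposition.** For every $n$, $\mathrm{II}(n)$ and $\mathrm{TR}(n)$ together imply $\mathrm{V}(n)$. -/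

import Mathlib

universe u v

/-! ## Reduced `ℓ²`-homology of a pair of subcomplexes of an order complex

The geometric realization of a poset `P` is the simplicial complex whose `i`-simplices are the
chains `p₀ < p₁ < ⋯ < pᵢ` of `P`. -/

namespace OrderComplex

/-- The `i`-simplices of the geometric realization of `P`: chains `p₀ < ⋯ < pᵢ`. -/
abbrev Simplex (P : Type*) [PartialOrder P] (i : ℕ) : Type _ := Fin (i + 1) ↪o P

/-- The `j`-th face of a simplex: delete the `j`-th vertex. -/
def face {P : Type*} [PartialOrder P] {i : ℕ} (σ : Simplex P (i + 1)) (j : Fin (i + 2)) :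
    Simplex P i :=
  (Fin.succAboveOrderEmb j).trans σ

/-- A subcomplex of the geometric realization of `P`. -/
structure Subcomplex (P : Type*) [PartialOrder P] where
  /-- the `i`-simplices of the subcomplex -/
  simplices : ∀ i : ℕ, Set (Simplex P i)
  face_mem : ∀ {i : ℕ} {σ : Simplex P (i + 1)}, σ ∈ simplices (i + 1) →
    ∀ j, face σ j ∈ simplices i

/-- Every element of `P` is comparable with only finitely many others, that is, the geometric
realization of `P` is a locally finite simplicial complex. -/
class IsLocallyFinite (P : Type*) [PartialOrder P] : Prop where
  finite_comparable : ∀ p : P, {q : P | q ≤ p ∨ p ≤ q}.Finite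

/-- The `i`-simplices of `X` which do not lie in `Y`. -/
abbrev RelSimplex {P : Type*} [PartialOrder P] (X Y : Subcomplex P) (i : ℕ) : Type _ :=
  {σ : Simplex P i // σ ∈ X.simplices i ∧ σ ∉ Y.simplices i}

open Classical in
/-- The incidence number of an `(i+1)`-simplex and an `i`-simplex, for the orientations given by
the ordering of the vertices: the coefficient of `τ` in `∑ j, (-1) ^ j • face σ j`. -/
noncomputable def incidence {P : Type*} [PartialOrder P] {i : ℕ} (σ : Simplex P (i + 1))
    (τ : Simplex P i) : ℝ :=
  ∑ j : Fin (i + 2), if face σ j = τ then (-1 : ℝ) ^ (j : ℕ) else 0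

theorem finite_cofaces {P : Type*} [PartialOrder P] [IsLocallyFinite P] {i : ℕ}
    (τ : Simplex P i) : {σ : Simplex P (i + 1) | ∃ j, face σ j = τ}.Finite := by
  have h : (Set.univ.pi fun _ : Fin (i + 2) => {q : P | q ≤ τ 0 ∨ τ 0 ≤ q}).Finite :=
    Set.Finite.pi fun _ => IsLocallyFinite.finite_comparable (τ 0)
  refine Set.Finite.of_finite_image (f := fun σ : Simplex P (i + 1) => (σ : Fin (i + 2) → P))
    (h.subset ?_) (DFunLike.coe_injective.injOn)
  rintro _ ⟨σ, ⟨j, rfl⟩, rfl⟩ k -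
  rcases le_total k (j.succAbove 0) with hk | hk
  · exact Or.inl (σ.monotone hk)
  · exact Or.inr (σ.monotone hk)

theorem finite_support_incidence {P : Type*} [PartialOrder P] [IsLocallyFinite P]
    {X Y : Subcomplex P} {i : ℕ} (f : RelSimplex X Y (i + 1) → ℝ) (τ : RelSimplex X Y i) :
    (Function.support fun σ : RelSimplex X Y (i + 1) => incidence σ.1 τ.1 * f σ).Finite := by
  refine ((finite_cofaces τ.1).preimage
    (Subtype.val_injective (p := fun σ => σ ∈ X.simplices (i + 1) ∧ σ ∉ Y.simplices (i + 1))).injOn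
    ).subset ?_
  intro σ hσ
  by_contra hne
  refine hσ ?_
  have : incidence σ.1 τ.1 = 0 :=
    Finset.sum_eq_zero fun j _ => if_neg fun hj => hne ⟨j, hj⟩
  simp [this]

/-- The boundary operator of the pair `(X, Y)` on (possibly infinite) simplicial chains; a chain is
given by its coefficients on the simplices of `X` which are not in `Y`. -/
noncomputable def relBoundary {P : Type*} [PartialOrder P] [IsLocallyFinite P]
    (X Y : Subcomplex P) (i : ℕ) : (RelSimplex X Y (i + 1) → ℝ) →ₗ[ℝ] (RelSimplex X Y i → ℝ) where
  toFun f τ := ∑ᶠ σ : RelSimplex X Y (i + 1), incidence σ.1 τ.1 * f σ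
  map_add' f g := by
    funext τ
    simp only [Pi.add_apply, mul_add]
    exact finsum_add_distrib (finite_support_incidence f τ) (finite_support_incidence g τ)
  map_smul' c f := by
    funext τ
    simp only [Pi.smul_apply, smul_eq_mul, RingHom.id_apply]
    rw [← smul_eq_mul, smul_finsum]
    exact finsum_congr fun σ => by rw [smul_eq_mul]; ring

/-- The Hilbert space of square-summable `i`-chains of the pair `(X, Y)`. -/
abbrev L2Chains {P : Type*} [PartialOrder P] (X Y : Subcomplex P) (i : ℕ) : Type _ :=
  lp (fun _ : RelSimplex X Y i => ℝ) 2

/-- The square-summable relative `i`-cycles. -/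
noncomputable def l2Cycles {P : Type*} [PartialOrder P] [IsLocallyFinite P]
    (X Y : Subcomplex P) : (i : ℕ) → Submodule ℝ (L2Chains X Y i)
  | 0 => ⊤
  | i + 1 =>
    { carrier := {z | relBoundary X Y i (z : RelSimplex X Y (i + 1) → ℝ) = 0}
      add_mem' := by
        intro a b ha hb
        simp only [Set.mem_ofPred_eq] at ha hb ⊢
        rw [lp.coeFn_add, map_add, ha, hb, add_zero]
      zero_mem' := by
        simp only [Set.mem_ofPred_eq]
        rw [lp.coeFn_zero, map_zero]
      smul_mem' := by
        intro c a ha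
        simp only [Set.mem_ofPred_eq] at ha ⊢
        rw [lp.coeFn_smul, map_smul, ha, smul_zero] }

/-- The boundaries of square-summable relative `(i+1)`-chains: the square-summable `i`-chains of the
form `∂ c` with `c` square-summable. -/
noncomputable def l2Boundaries {P : Type*} [PartialOrder P] [IsLocallyFinite P]
    (X Y : Subcomplex P) (i : ℕ) : Submodule ℝ (L2Chains X Y i) where
  carrier := {b | ∃ c : L2Chains X Y (i + 1),
    relBoundary X Y i (c : RelSimplex X Y (i + 1) → ℝ) = (b : RelSimplex X Y i → ℝ)}
  add_mem' := by
    rintro a b ⟨c, hc⟩ ⟨d, hd⟩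
    exact ⟨c + d, by rw [lp.coeFn_add, map_add, hc, hd, lp.coeFn_add]⟩
  zero_mem' := ⟨0, by rw [lp.coeFn_zero, map_zero, lp.coeFn_zero]⟩
  smul_mem' := by
    rintro r a ⟨c, hc⟩
    exact ⟨r • c, by rw [lp.coeFn_smul, map_smul, hc, lp.coeFn_smul]⟩

/-- The reduced `ℓ²`-homology of the pair `(X, Y)`: square-summable cycles modulo the closure of
the boundaries of square-summable chains. -/
abbrev ReducedL2Homology {P : Type*} [PartialOrder P] [IsLocallyFinite P]
    (X Y : Subcomplex P) (i : ℕ) : Type _ :=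
  l2Cycles X Y i ⧸ (l2Boundaries X Y i).topologicalClosure.comap (l2Cycles X Y i).subtype

end OrderComplex

/-! ## The Davis complex of a Coxeter system and its ruins -/

namespace Davis

/-- The subgroup `W_T` generated by `T ⊆ S`. -/
def parabolic {B W : Type*} [Group W] {M : CoxeterMatrix B} (cs : CoxeterSystem M W)
    (T : Set B) : Subgroup W :=
  Subgroup.closure (cs.simple '' T)

/-- `T ⊆ S` is spherical if `W_T` is finite. -/
def IsSpherical {B W : Type*} [Group W] {M : CoxeterMatrix B} (cs : CoxeterSystem M W)
    (T : Set B) : Prop :=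
  Finite (parabolic cs T)

/-! ### A generator in `W_T` belongs to `T`

This is what makes the type of a coset `w W_T` well defined. It is proved with the canonical
reflection representation. -/

/-- The linear form `2 B(e_s, ·)` of the canonical representation. -/
noncomputable def rootForm {B : Type*} (M : CoxeterMatrix B) (s : B) : Module.Dual ℝ (B →₀ ℝ) :=
  Finsupp.linearCombination ℝ fun t => -2 * Real.cos (Real.pi / (M s t : ℝ))

theorem rootForm_single {B : Type*} (M : CoxeterMatrix B) (s t : B) :
    rootForm M s (Finsupp.single t 1) = -2 * Real.cos (Real.pi / (M s t : ℝ)) := by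
  simp [rootForm]

theorem rootForm_self {B : Type*} (M : CoxeterMatrix B) (s : B) :
    rootForm M s (Finsupp.single s 1) = 2 := by
  rw [rootForm_single, M.diagonal]; simp

/-- The reflection by which `s` acts in the canonical representation. -/
noncomputable def rootReflection {B : Type*} (M : CoxeterMatrix B) (s : B) :
    (B →₀ ℝ) ≃ₗ[ℝ] (B →₀ ℝ) :=
  Module.reflection (rootForm_self M s)

open Polynomial.Chebyshev in
theorem chebyshev_products_eq_zero (m : ℕ) (hm : 3 ≤ m) :
    ((S ℝ (((m : ℤ) - 2) / 2)).eval (2 * Real.cos (2 * (Real.pi / m))) *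
      ((S ℝ (((m : ℤ) - 1) / 2)).eval (2 * Real.cos (2 * (Real.pi / m))) +
        (S ℝ (((m : ℤ) - 3) / 2)).eval (2 * Real.cos (2 * (Real.pi / m)))) = 0) ∧
    ((S ℝ (((m : ℤ) - 1) / 2)).eval (2 * Real.cos (2 * (Real.pi / m))) *
      ((S ℝ ((m : ℤ) / 2)).eval (2 * Real.cos (2 * (Real.pi / m))) +
        (S ℝ (((m : ℤ) - 2) / 2)).eval (2 * Real.cos (2 * (Real.pi / m)))) = 0) := by
  have hm' : (3 : ℝ) ≤ m := by exact_mod_cast hm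
  have hm0 : (m : ℝ) ≠ 0 := by positivity
  set φ : ℝ := 2 * (Real.pi / m) with hφ
  have hsin : Real.sin φ ≠ 0 := by
    refine (Real.sin_pos_of_pos_of_lt_pi (by positivity) ?_).ne'
    rw [hφ, ← mul_div_assoc, div_lt_iff₀ (by positivity)]
    nlinarith [Real.pi_pos]
  have key (k : ℤ) := S_two_mul_real_cos φ k
  obtain ⟨k, hk | hk⟩ : ∃ k : ℤ, (m : ℤ) = 2 * k ∨ (m : ℤ) = 2 * k + 1 :=
    ⟨(m : ℤ) / 2, by omega⟩
  · have e1 : ((m : ℤ) - 2) / 2 = k - 1 := by omega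
    have e2 : ((m : ℤ) - 1) / 2 = k - 1 := by omega
    have hz : (S ℝ (k - 1)).eval (2 * Real.cos φ) = 0 := by
      have h := key (k - 1)
      have hkr : (m : ℝ) = 2 * k := by exact_mod_cast hk
      have : ((k - 1 : ℤ) + 1 : ℝ) * φ = Real.pi := by
        push_cast
        rw [hφ]; field_simp; rw [hkr]; ring
      rw [this, Real.sin_pi] at h
      exact (mul_eq_zero.1 h).resolve_right hsin
    rw [e1, e2, hz]
    simp
  · have e1 : ((m : ℤ) - 2) / 2 = k - 1 := by omega
    have e2 : ((m : ℤ) - 1) / 2 = k := by omega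
    have e3 : ((m : ℤ) - 3) / 2 = k - 1 := by omega
    have e4 : (m : ℤ) / 2 = k := by omega
    have hz : (S ℝ k).eval (2 * Real.cos φ) + (S ℝ (k - 1)).eval (2 * Real.cos φ) = 0 := by
      have h := key k
      have h' := key (k - 1)
      have hkr : (m : ℝ) = 2 * k + 1 := by exact_mod_cast hk
      have : ((k : ℝ) + 1) * φ = 2 * Real.pi - ((k - 1 : ℤ) + 1 : ℝ) * φ := by
        push_cast
        rw [hφ]; field_simp; rw [hkr]; ring
      rw [this, Real.sin_two_pi_sub, ← h'] at h
      refine (mul_eq_zero.1 (?_ : _ * Real.sin φ = 0)).resolve_right hsin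
      linear_combination h
    rw [e1, e2, e3, e4, hz]
    simp

theorem rootReflection_isLiftable {B : Type*} (M : CoxeterMatrix B) :
    M.IsLiftable (rootReflection M) := by
  intro s s'
  set m := M s s' with hm
  have hfy : rootForm M s (Finsupp.single s' 1) = -2 * Real.cos (Real.pi / m) := rootForm_single ..
  have hgx : rootForm M s' (Finsupp.single s 1) = -2 * Real.cos (Real.pi / m) := by
    rw [rootForm_single, M.symmetric]
  rcases eq_or_ne s s' with rfl | hne
  · have : m = 1 := M.diagonal s
    rw [this, pow_one]
    exact LinearEquiv.ext fun z => Module.involutive_reflection (rootForm_self M s) z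
  have hm1 : m ≠ 1 := M.off_diagonal s s' hne
  apply LinearEquiv.ext
  intro z
  rw [rootReflection, rootReflection, Module.reflection_mul_reflection_pow_apply
    (rootForm_self M s) (rootForm_self M s') m z _ rfl, hfy, hgx]
  have ht : -2 * Real.cos (Real.pi / m) * (-2 * Real.cos (Real.pi / m)) - 2 =
      2 * Real.cos (2 * (Real.pi / m)) := by
    rw [Real.cos_two_mul]; ring
  rw [ht]
  rcases lt_or_ge m 3 with h3 | h3
  · obtain h0 | h2 : m = 0 ∨ m = 2 := by omega
    · simp [h0]
    · rw [h2]
      have e : (2 : ℝ) * (Real.pi / (2 : ℕ)) = Real.pi := by push_cast; ring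
      rw [e]
      norm_num
      abel
  · obtain ⟨hA, hB⟩ := chebyshev_products_eq_zero m h3
    rw [hA, hB]
    simp

/-- The canonical reflection representation of a Coxeter group. -/
noncomputable def canonicalRep {B W : Type*} [Group W] {M : CoxeterMatrix B}
    (cs : CoxeterSystem M W) : W →* ((B →₀ ℝ) ≃ₗ[ℝ] (B →₀ ℝ)) :=
  cs.lift ⟨rootReflection M, rootReflection_isLiftable M⟩

theorem canonicalRep_sub_mem {B W : Type*} [Group W] {M : CoxeterMatrix B}
    (cs : CoxeterSystem M W) (T : Set B) {w : W} (hw : w ∈ parabolic cs T) :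
    ∀ z, canonicalRep cs w z - z ∈
      Submodule.span ℝ ((fun t => Finsupp.single t (1 : ℝ)) '' T) := by
  induction hw using Subgroup.closure_induction with
  | mem x hx =>
    obtain ⟨t, ht, rfl⟩ := hx
    intro z
    have : canonicalRep cs (cs.simple t) = rootReflection M t := cs.lift_apply_simple _ t
    rw [this, rootReflection, Module.reflection_apply, sub_sub_cancel_left]
    exact neg_mem (Submodule.smul_mem _ _ (Submodule.subset_span ⟨t, ht, rfl⟩))
  | one => intro z; simp
  | mul x y _ _ hx hy =>
    intro z
    have := add_mem (hx (canonicalRep cs y z)) (hy z)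
    rw [sub_add_sub_cancel] at this
    rwa [map_mul, LinearEquiv.mul_apply]
  | inv x _ hx =>
    intro z
    have := neg_mem (hx (canonicalRep cs x⁻¹ z))
    rwa [← LinearEquiv.mul_apply, ← map_mul, mul_inv_cancel, map_one, neg_sub] at this

theorem simple_mem_parabolic_iff {B W : Type*} [Group W] {M : CoxeterMatrix B}
    (cs : CoxeterSystem M W) (T : Set B) (s : B) : cs.simple s ∈ parabolic cs T ↔ s ∈ T := by
  refine ⟨fun h => ?_, fun h => Subgroup.subset_closure ⟨s, h, rfl⟩⟩
  have h1 := canonicalRep_sub_mem cs T h (Finsupp.single s 1)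
  have h2 : canonicalRep cs (cs.simple s) = rootReflection M s := cs.lift_apply_simple _ s
  rw [h2, rootReflection, Module.reflection_apply_self] at h1
  rw [← Finsupp.supported_eq_span_single, Finsupp.mem_supported] at h1
  exact h1 (by norm_num)

/-! ### The Davis complex -/

/-- A spherical coset `w W_T`, `T ⊆ S` spherical. These are the (Coxeter) cells of the Davis
complex; `T` is the type of the cell. -/
structure SphericalCoset {B W : Type*} [Group W] {M : CoxeterMatrix B}
    (cs : CoxeterSystem M W) where
  /-- the coset as a subset of `W` -/
  carrier : Set W
  /-- the type `T`, which is determined by the coset -/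
  cellType : Set B
  spherical : IsSpherical cs cellType
  exists_eq_coset : ∃ w : W, carrier = (fun p => w * p) '' (parabolic cs cellType : Set W)

namespace SphericalCoset

theorem carrier_eq_of_mem {B W : Type*} [Group W] {M : CoxeterMatrix B}
    {cs : CoxeterSystem M W} (c : SphericalCoset cs) {w : W} (hw : w ∈ c.carrier) :
    c.carrier = (fun p => w * p) '' (parabolic cs c.cellType : Set W) := by
  obtain ⟨v, hv⟩ := c.exists_eq_coset
  rw [hv] at hw ⊢
  obtain ⟨p, hp, rfl⟩ := hw
  ext x
  constructor
  · rintro ⟨q, hq, rfl⟩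
    exact ⟨p⁻¹ * q, mul_mem (inv_mem hp) hq, by simp [mul_assoc]⟩
  · rintro ⟨q, hq, rfl⟩
    exact ⟨p * q, mul_mem hp hq, by simp [mul_assoc]⟩

theorem carrier_nonempty {B W : Type*} [Group W] {M : CoxeterMatrix B}
    {cs : CoxeterSystem M W} (c : SphericalCoset cs) : c.carrier.Nonempty := by
  obtain ⟨v, hv⟩ := c.exists_eq_coset
  exact ⟨v, by rw [hv]; exact ⟨1, one_mem _, mul_one v⟩⟩

theorem cellType_subset_of_carrier_subset {B W : Type*} [Group W] {M : CoxeterMatrix B}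
    {cs : CoxeterSystem M W} {c d : SphericalCoset cs} (h : c.carrier ⊆ d.carrier) :
    c.cellType ⊆ d.cellType := by
  obtain ⟨w, hw⟩ := c.carrier_nonempty
  intro s hs
  have h1 : w * cs.simple s ∈ d.carrier := h <| by
    rw [c.carrier_eq_of_mem hw]
    exact ⟨_, Subgroup.subset_closure ⟨s, hs, rfl⟩, rfl⟩
  rw [d.carrier_eq_of_mem (h hw)] at h1
  obtain ⟨p, hp, hps⟩ := h1
  rw [mul_left_cancel hps] at hp
  exact (simple_mem_parabolic_iff cs _ s).1 hp

theorem carrier_injective {B W : Type*} [Group W] {M : CoxeterMatrix B}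
    (cs : CoxeterSystem M W) :
    Function.Injective (carrier : SphericalCoset cs → Set W) := by
  intro c d h
  have ht : c.cellType = d.cellType :=
    (cellType_subset_of_carrier_subset h.subset).antisymm
      (cellType_subset_of_carrier_subset h.symm.subset)
  cases c; cases d
  simp only at h ht
  subst h ht
  rfl

/-- The poset `W𝒮` of spherical cosets, ordered by inclusion. The Davis complex is its geometric
realization. -/
instance {B W : Type*} [Group W] {M : CoxeterMatrix B} (cs : CoxeterSystem M W) :
    PartialOrder (SphericalCoset cs) :=
  PartialOrder.lift carrier (carrier_injective cs)

theorem le_iff {B W : Type*} [Group W] {M : CoxeterMatrix B} {cs : CoxeterSystem M W}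
    {c d : SphericalCoset cs} : c ≤ d ↔ c.carrier ⊆ d.carrier := Iff.rfl

theorem finite_carrier {B W : Type*} [Group W] {M : CoxeterMatrix B} {cs : CoxeterSystem M W}
    (c : SphericalCoset cs) : c.carrier.Finite := by
  obtain ⟨v, hv⟩ := c.exists_eq_coset
  have : Finite (parabolic cs c.cellType) := c.spherical
  rw [hv]
  exact (Set.toFinite (parabolic cs c.cellType : Set W)).image _

instance {B W : Type*} [Finite B] [Group W] {M : CoxeterMatrix B} (cs : CoxeterSystem M W) :
    OrderComplex.IsLocallyFinite (SphericalCoset cs) where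
  finite_comparable c := by
    have h1 : {d : SphericalCoset cs | d ≤ c}.Finite :=
      Set.Finite.of_finite_image (f := carrier)
        (c.finite_carrier.finite_subsets.subset (by rintro _ ⟨d, hd, rfl⟩; exact hd))
        (carrier_injective cs).injOn
    have h2 : {d : SphericalCoset cs | c ≤ d}.Finite := by
      obtain ⟨w, hw⟩ := c.carrier_nonempty
      refine Set.Finite.of_finite_image (f := cellType) (Set.toFinite _) ?_
      intro d hd e he hde
      apply carrier_injective cs
      rw [d.carrier_eq_of_mem (hd hw), e.carrier_eq_of_mem (he hw), hde]
    exact h1.union h2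

end SphericalCoset

/-- The union of the closed Coxeter cells belonging to `A`, as a subcomplex of the Davis complex.
The closed cell of a spherical coset `c` is the geometric realization of the poset of spherical
cosets contained in `c`. -/
def unionOfCells {B W : Type*} [Group W] {M : CoxeterMatrix B} {cs : CoxeterSystem M W}
    (A : Set (SphericalCoset cs)) : OrderComplex.Subcomplex (SphericalCoset cs) where
  simplices i := {σ | ∃ c ∈ A, ∀ j : Fin (i + 1), σ j ≤ c}
  face_mem := by
    rintro i σ ⟨c, hc, h⟩ j
    exact ⟨c, hc, fun k => h _⟩

/-- `Ω(U, T)`: the union of the closed cells whose type `T'` satisfies `T ⊆ T' ⊆ U`. -/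
def ruin {B W : Type*} [Group W] {M : CoxeterMatrix B} (cs : CoxeterSystem M W)
    (U T : Set B) : OrderComplex.Subcomplex (SphericalCoset cs) :=
  unionOfCells {c | T ⊆ c.cellType ∧ c.cellType ⊆ U}

/-- `∂Ω(U, T)`: the cells of `Ω(U, T)` whose type does not contain `T`. -/
def ruinBoundary {B W : Type*} [Group W] {M : CoxeterMatrix B} (cs : CoxeterSystem M W)
    (U T : Set B) : OrderComplex.Subcomplex (SphericalCoset cs) :=
  unionOfCells {c | (∃ d : SphericalCoset cs, (T ⊆ d.cellType ∧ d.cellType ⊆ U) ∧ c ≤ d) ∧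
    ¬ T ⊆ c.cellType}

/-- The geometric realization of the nerve `L` of `(W, S)`, the simplicial complex with vertex
set `S` whose simplices are the non-empty spherical subsets of `S`: points are given by their
barycentric coordinates. -/
def nerveRealization {B W : Type*} [Fintype B] [Group W] {M : CoxeterMatrix B}
    (cs : CoxeterSystem M W) : Set (B → ℝ) :=
  {x | x ∈ stdSimplex ℝ B ∧ IsSpherical cs (Function.support x)}

/-- The nerve is a triangulation of the sphere `S^{n-1}` (which is empty if `n = 0`). -/
def NerveTriangulatesSphere {B W : Type*} [Fintype B] [Group W] {M : CoxeterMatrix B}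
    (cs : CoxeterSystem M W) (n : ℕ) : Prop :=
  Nonempty (nerveRealization cs ≃ₜ Metric.sphere (0 : EuclideanSpace ℝ (Fin n)) 1)

/-- `ℋ_i(Ω(U, T), ∂Ω(U, T)) = 0`. -/
def RuinHomologyVanishes {B W : Type*} [Finite B] [Group W] {M : CoxeterMatrix B}
    (cs : CoxeterSystem M W) (U T : Set B) (i : ℕ) : Prop :=
  Subsingleton (OrderComplex.ReducedL2Homology (ruin cs U T) (ruinBoundary cs U T) i)

/-! ### The three conjectures -/

/-- `II(n)`: for every Coxeter system whose nerve is a triangulation of `S^{n-1}` and every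
`t ∈ S`, `ℋ_i(Ω(S, t), ∂Ω(S, t)) = 0` for `i > n / 2`. -/
def ConjectureII (n : ℕ) : Prop :=
  ∀ (B : Type u) [Fintype B] (W : Type v) [Group W] (M : CoxeterMatrix B)
    (cs : CoxeterSystem M W), NerveTriangulatesSphere cs n →
    ∀ t : B, ∀ i : ℕ, (n : ℝ) / 2 < i → RuinHomologyVanishes cs Set.univ {t} i

/-- `TR(n)`: for every Coxeter system whose nerve is a triangulation of `S^{n-1}`, every `V ⊆ S`
and every two-element spherical `T ⊆ V`, `ℋ_i(Ω(V, T), ∂Ω(V, T)) = 0` for `i > n / 2 + 1`. -/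
def ConjectureTR (n : ℕ) : Prop :=
  ∀ (B : Type u) [Fintype B] (W : Type v) [Group W] (M : CoxeterMatrix B)
    (cs : CoxeterSystem M W), NerveTriangulatesSphere cs n →
    ∀ V T : Set B, T ⊆ V → IsSpherical cs T → T.ncard = 2 →
    ∀ i : ℕ, (n : ℝ) / 2 + 1 < i → RuinHomologyVanishes cs V T i

/-- `V(n)`: for every Coxeter system whose nerve is a triangulation of `S^{n-1}`, every `V ⊆ S`
and every `t ∈ V`, `ℋ_i(Ω(V, t), ∂Ω(V, t)) = 0` for `i > n / 2`. -/
def ConjectureV (n : ℕ) : Prop :=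
  ∀ (B : Type u) [Fintype B] (W : Type v) [Group W] (M : CoxeterMatrix B)
    (cs : CoxeterSystem M W), NerveTriangulatesSphere cs n →
    ∀ V : Set B, ∀ t ∈ V, ∀ i : ℕ, (n : ℝ) / 2 < i → RuinHomologyVanishes cs V {t} i

end Davis

open Filter Topology InnerProductSpace ContinuousLinearMap

set_option linter.unusedSectionVars false

/-! ## Von Neumann traces of equivariant operators -/

namespace EquivariantHilbert

variable {G : Type*} [Group G]
  {H : Type*} [NormedAddCommGroup H] [InnerProductSpace ℝ H] [CompleteSpace H]
  {H' : Type*} [NormedAddCommGroup H'] [InnerProductSpace ℝ H'] [CompleteSpace H']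

theorem inner_unitary_left (U : G →* (H ≃ₗᵢ[ℝ] H)) (g : G) (x y : H) :
    inner ℝ (U g x) y = inner ℝ x (U g⁻¹ y) := by
  have h : U g (U g⁻¹ y) = y := by
    change (U g * U g⁻¹) y = y
    rw [← map_mul, mul_inv_cancel, map_one]
    rfl
  rw [← (U g).inner_map_map x (U g⁻¹ y), h]

theorem inner_unitary_right (U : G →* (H ≃ₗᵢ[ℝ] H)) (g : G) (x y : H) :
    inner ℝ x (U g y) = inner ℝ (U g⁻¹ x) y := by
  rw [inner_unitary_left, inv_inv]

/-- A bounded operator is equivariant. -/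
def IsEquivariant (U : G →* (H ≃ₗᵢ[ℝ] H)) (U' : G →* (H' ≃ₗᵢ[ℝ] H')) (f : H →L[ℝ] H') : Prop :=
  ∀ g x, f (U g x) = U' g (f x)

theorem IsEquivariant.adjoint {U : G →* (H ≃ₗᵢ[ℝ] H)} {U' : G →* (H' ≃ₗᵢ[ℝ] H')}
    {f : H →L[ℝ] H'} (hf : IsEquivariant U U' f) : IsEquivariant U' U (adjoint f) := by
  intro g x
  refine ext_inner_right ℝ fun y => ?_
  rw [adjoint_inner_left, inner_unitary_left, inner_unitary_left, adjoint_inner_left, hf]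

theorem IsEquivariant.starProjection {U : G →* (H ≃ₗᵢ[ℝ] H)} {K : Submodule ℝ H}
    [K.HasOrthogonalProjection] (hK : ∀ g, ∀ x ∈ K, U g x ∈ K) :
    IsEquivariant U U K.starProjection := by
  intro g x
  refine (Submodule.eq_starProjection_of_mem_of_inner_eq_zero (hK g _ (Submodule.starProjection_apply_mem K x)) ?_)
  intro w hw
  rw [← map_sub, inner_unitary_left]
  exact K.starProjection_inner_eq_zero _ _ (hK _ _ hw)

/-- A finite family of vectors whose translates form a Parseval frame. -/
structure ParsevalFrame (U : G →* (H ≃ₗᵢ[ℝ] H)) (ι : Type*) where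
  /-- the finite index set -/
  index : Finset ι
  /-- the generating vectors -/
  vec : ι → H
  hasSum_norm_sq : ∀ x : H,
    HasSum (fun g : G => ∑ j ∈ index, (inner ℝ x (U g (vec j))) ^ 2) (‖x‖ ^ 2)

namespace ParsevalFrame

variable {U : G →* (H ≃ₗᵢ[ℝ] H)} {U' : G →* (H' ≃ₗᵢ[ℝ] H')} {ι ι' : Type*}

theorem hasSum_inner (E : ParsevalFrame U ι) (x y : H) :
    HasSum (fun g : G => ∑ j ∈ E.index, inner ℝ x (U g (E.vec j)) * inner ℝ (U g (E.vec j)) y)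
      (inner ℝ x y) := by
  have h := ((E.hasSum_norm_sq (x + y)).sub (E.hasSum_norm_sq (x - y))).mul_left (1 / 4)
  have e : (fun g : G => ∑ j ∈ E.index, inner ℝ x (U g (E.vec j)) * inner ℝ (U g (E.vec j)) y) =
      fun g => 1 / 4 * (∑ j ∈ E.index, (inner ℝ (x + y) (U g (E.vec j))) ^ 2 -
        ∑ j ∈ E.index, (inner ℝ (x - y) (U g (E.vec j))) ^ 2) := by
    funext g
    rw [← Finset.sum_sub_distrib, Finset.mul_sum]
    refine Finset.sum_congr rfl fun j _ => ?_
    rw [inner_add_left, inner_sub_left, real_inner_comm y]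
    ring
  have e' : inner ℝ x y = 1 / 4 * (‖x + y‖ ^ 2 - ‖x - y‖ ^ 2) := by
    rw [norm_add_sq_real, norm_sub_sq_real]
    ring
  rw [e, e']
  exact h

theorem eq_zero_of_inner_eq_zero (E : ParsevalFrame U ι) {x : H}
    (h : ∀ g, ∀ j ∈ E.index, inner ℝ x (U g (E.vec j)) = 0) : x = 0 := by
  have h1 := E.hasSum_norm_sq x
  have h2 : (fun g : G => ∑ j ∈ E.index, (inner ℝ x (U g (E.vec j))) ^ 2) = fun _ => 0 := by
    funext g
    exact Finset.sum_eq_zero fun j hj => by rw [h g j hj]; ring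
  rw [h2] at h1
  have := h1.unique hasSum_zero
  simpa using this

/-- The von Neumann trace of an operator. -/
noncomputable def trace (E : ParsevalFrame U ι) (T : H →L[ℝ] H) : ℝ :=
  ∑ j ∈ E.index, inner ℝ (T (E.vec j)) (E.vec j)

theorem trace_sub (E : ParsevalFrame U ι) (S T : H →L[ℝ] H) :
    E.trace (S - T) = E.trace S - E.trace T := by
  simp [trace, inner_sub_left]

theorem hasSum_trace_comp (E : ParsevalFrame U ι) (E' : ParsevalFrame U' ι')
    (f : H →L[ℝ] H') (g : H' →L[ℝ] H) :
    HasSum (fun γ : G => ∑ j ∈ E.index, ∑ k ∈ E'.index,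
      inner ℝ (f (E.vec j)) (U' γ (E'.vec k)) * inner ℝ (g (U' γ (E'.vec k))) (E.vec j))
      (E.trace (g ∘L f)) := by
  refine hasSum_sum fun j _ => ?_
  rw [comp_apply, ← adjoint_inner_right]
  convert E'.hasSum_inner (f (E.vec j)) (adjoint g (E.vec j)) using 4
  rw [adjoint_inner_right]

theorem trace_comp_comm (E : ParsevalFrame U ι) (E' : ParsevalFrame U' ι')
    {f : H →L[ℝ] H'} {g : H' →L[ℝ] H} (hf : IsEquivariant U U' f) (hg : IsEquivariant U' U g) :
    E.trace (g ∘L f) = E'.trace (f ∘L g) := by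
  have h1 := (Equiv.inv G).hasSum_iff.2 (E.hasSum_trace_comp E' f g)
  refine h1.unique ?_
  convert E'.hasSum_trace_comp E g f using 1
  funext γ
  simp only [Function.comp, Equiv.inv_apply]
  rw [Finset.sum_comm]
  refine Finset.sum_congr rfl fun k _ => Finset.sum_congr rfl fun j _ => ?_
  rw [hg, inner_unitary_left, inner_unitary_right, inv_inv, hf, mul_comm]

theorem tendsto_trace (E : ParsevalFrame U ι) {T : ℕ → H →L[ℝ] H} {S : H →L[ℝ] H}
    (h : ∀ x, Tendsto (fun n => T n x) atTop (𝓝 (S x))) :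
    Tendsto (fun n => E.trace (T n)) atTop (𝓝 (E.trace S)) :=
  tendsto_finsetSum _ fun j _ => (h (E.vec j)).inner tendsto_const_nhds

end ParsevalFrame

theorem norm_one_sub_adjoint_comp_self_le {f : H →L[ℝ] H'} (hf : ‖f‖ ≤ 1) :
    ‖(1 : H →L[ℝ] H) - adjoint f ∘L f‖ ≤ 1 := by
  refine opNorm_le_bound _ zero_le_one fun x => ?_
  rw [one_mul]
  refine le_of_sq_le_sq ?_ (norm_nonneg x)
  have h1 : ‖adjoint f (f x)‖ ≤ ‖f x‖ :=
    ((adjoint f).le_of_opNorm_le (by rwa [LinearIsometryEquiv.norm_map]) _).trans (one_mul _).le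
  have h2 : inner ℝ x (adjoint f (f x)) = ‖f x‖ ^ 2 := by
    rw [adjoint_inner_right, real_inner_self_eq_norm_sq]
  have h3 := norm_sub_sq_real x (adjoint f (f x))
  have h4 : ((1 : H →L[ℝ] H) - adjoint f ∘L f) x = x - adjoint f (f x) := rfl
  rw [h4, h3, h2]
  nlinarith [norm_nonneg (adjoint f (f x)), norm_nonneg (f x)]

/-- The averages of the powers of `1 - f†f`. -/
noncomputable def kerAverage (f : H →L[ℝ] H') (n : ℕ) : H →L[ℝ] H :=
  (n : ℝ)⁻¹ • ∑ k ∈ Finset.range n, (1 - adjoint f ∘L f) ^ k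

theorem tendsto_kerAverage {f : H →L[ℝ] H'} (hf : ‖f‖ ≤ 1) (x : H) :
    Tendsto (fun n => kerAverage f n x) atTop (𝓝 (f.ker.starProjection x)) := by
  have h := ContinuousLinearMap.tendsto_birkhoffAverage_orthogonalProjection _
    (norm_one_sub_adjoint_comp_self_le hf) x
  have hK : (1 - adjoint f ∘L f).eqLocus (1 : H →L[ℝ] H) = f.ker := by
    ext y
    have : y - adjoint f (f y) = y ↔ f y = 0 := by
      rw [sub_eq_self]
      refine ⟨fun hy => ?_, fun hy => by rw [hy, map_zero]⟩
      have : inner ℝ y (adjoint f (f y)) = ‖f y‖ ^ 2 := by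
        rw [adjoint_inner_right, real_inner_self_eq_norm_sq]
      rw [hy, inner_zero_right] at this
      simpa using this.symm
    exact this
  have hP : ∀ (K : Submodule ℝ H) [K.HasOrthogonalProjection], K = f.ker →
      K.starProjection x = f.ker.starProjection x := by
    rintro K _ rfl
    rfl
  rw [← hP _ hK]
  refine h.congr fun n => ?_
  simp [kerAverage, birkhoffAverage, birkhoffSum]

namespace ParsevalFrame

variable {U : G →* (H ≃ₗᵢ[ℝ] H)} {U' : G →* (H' ≃ₗᵢ[ℝ] H')} {ι ι' : Type*}

theorem trace_one_sub_pow (E : ParsevalFrame U ι) (E' : ParsevalFrame U' ι')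
    {f : H →L[ℝ] H'} (hf : IsEquivariant U U' f) (n : ℕ) :
    E.trace ((1 - adjoint f ∘L f) ^ n) - E'.trace ((1 - f ∘L adjoint f) ^ n) =
      E.trace 1 - E'.trace 1 := by
  set A : H →L[ℝ] H := 1 - adjoint f ∘L f with hA
  set B : H' →L[ℝ] H' := 1 - f ∘L adjoint f with hB
  have hpow : ∀ k : ℕ, adjoint f ∘L (B ^ k) = (A ^ k) ∘L adjoint f := by
    intro k
    induction k with
    | zero => rfl
    | succ k ih =>
      have h1 : adjoint f ∘L B = A ∘L adjoint f := by
        ext x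
        simp [hA, hB]
      calc adjoint f ∘L (B ^ (k + 1)) = (adjoint f ∘L (B ^ k)) ∘L B := by rw [pow_succ]; rfl
        _ = (A ^ k) ∘L (adjoint f ∘L B) := by rw [ih]; rfl
        _ = (A ^ (k + 1)) ∘L adjoint f := by rw [h1, pow_succ]; rfl
  have hBeq : ∀ k : ℕ, IsEquivariant U' U' (B ^ k) := by
    intro k
    induction k with
    | zero => exact fun _ _ => rfl
    | succ k ih =>
      intro g x
      have h1 : B (U' g x) = U' g (B x) := by
        simp [hB, hf.adjoint g x, hf g (adjoint f x)]
      rw [pow_succ]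
      change (B ^ k) (B (U' g x)) = _
      rw [h1, ih g]
      rfl
  set g : H' →L[ℝ] H := adjoint f ∘L ∑ k ∈ Finset.range n, B ^ k with hg
  have hgeq : IsEquivariant U' U g := by
    intro γ x
    simp only [hg, comp_apply, sum_apply, ← hf.adjoint γ, map_sum]
    exact Finset.sum_congr rfl fun k _ => by rw [hBeq k γ]
  have h1 : g ∘L f = 1 - A ^ n := by
    have : g = (∑ k ∈ Finset.range n, A ^ k) ∘L adjoint f := by
      simp only [hg, comp_finsetSum, finsetSum_comp, hpow]
    rw [this, ← geom_sum_mul_neg, hA, sub_sub_cancel]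
    rfl
  have h2 : f ∘L g = 1 - B ^ n := by
    rw [← mul_neg_geom_sum, hB, sub_sub_cancel]
    rfl
  have := E.trace_comp_comm E' hf hgeq
  rw [h1, h2, trace_sub, trace_sub] at this
  linarith

theorem trace_average (E : ParsevalFrame U ι) (A : H →L[ℝ] H) (n : ℕ) :
    E.trace ((n : ℝ)⁻¹ • ∑ k ∈ Finset.range n, A ^ k) =
      (n : ℝ)⁻¹ * ∑ k ∈ Finset.range n, E.trace (A ^ k) := by
  simp only [trace, smul_apply, sum_apply, inner_smul_left, sum_inner, ← Finset.mul_sum]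
  rw [Finset.sum_comm]
  rfl

theorem trace_kerAverage (E : ParsevalFrame U ι) (E' : ParsevalFrame U' ι')
    {f : H →L[ℝ] H'} (hf : IsEquivariant U U' f) {n : ℕ} (hn : n ≠ 0) :
    E.trace (kerAverage f n) - E'.trace (kerAverage (adjoint f) n) = E.trace 1 - E'.trace 1 := by
  rw [kerAverage, kerAverage, trace_average, trace_average, adjoint_adjoint, ← mul_sub,
    ← Finset.sum_sub_distrib, Finset.sum_congr rfl fun k _ => E.trace_one_sub_pow E' hf k]
  rw [Finset.sum_const, Finset.card_range, nsmul_eq_mul, inv_mul_cancel_left₀]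
  exact_mod_cast hn

theorem trace_starProjection_ker (E : ParsevalFrame U ι) (E' : ParsevalFrame U' ι')
    {f : H →L[ℝ] H'} (hf : IsEquivariant U U' f) (hf1 : ‖f‖ ≤ 1) :
    E.trace f.ker.starProjection - E'.trace (adjoint f).ker.starProjection =
      E.trace 1 - E'.trace 1 := by
  have h := (E.tendsto_trace (tendsto_kerAverage hf1)).sub
    (E'.tendsto_trace (tendsto_kerAverage
      (f := adjoint f) (by rwa [LinearIsometryEquiv.norm_map])))
  refine tendsto_nhds_unique h (tendsto_const_nhds.congr' ?_)
  filter_upwards [eventually_ne_atTop 0] with n hn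
  exact (E.trace_kerAverage E' hf hn).symm

/-- A submodule whose trace does not exceed that of a smaller one equals it. -/
theorem le_of_trace_starProjection_le (E : ParsevalFrame U ι) {K L : Submodule ℝ H}
    [K.HasOrthogonalProjection] [L.HasOrthogonalProjection]
    (hK : ∀ g, ∀ x ∈ K, U g x ∈ K) (hL : ∀ g, ∀ x ∈ L, U g x ∈ L) (hKL : K ≤ L)
    (h : E.trace L.starProjection ≤ E.trace K.starProjection) : L ≤ K := by
  have hP : ∀ z, K.starProjection z = K.starProjection (L.starProjection z) := fun z =>
    (congrArg (fun f : H →L[ℝ] H => f z)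
      (Submodule.starProjection_comp_starProjection_of_le hKL)).symm
  have hnorm : ∀ (N : Submodule ℝ H) [N.HasOrthogonalProjection] (z : H),
      inner ℝ (N.starProjection z) z = ‖N.starProjection z‖ ^ 2 := by
    intro N _ z
    have := N.starProjection_inner_eq_zero z _ (N.starProjection_apply_mem z)
    rw [inner_sub_left, real_inner_self_eq_norm_sq, real_inner_comm] at this
    linarith
  have hpyth : ∀ z, ‖L.starProjection z‖ ^ 2 =
      ‖K.starProjection z‖ ^ 2 + ‖L.starProjection z - K.starProjection z‖ ^ 2 := by
    intro z
    have h0 : inner ℝ (L.starProjection z - K.starProjection z) (K.starProjection z) = 0 := by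
      rw [hP z]
      exact K.starProjection_inner_eq_zero _ _ (K.starProjection_apply_mem _)
    have h1 := norm_add_sq_real (L.starProjection z - K.starProjection z) (K.starProjection z)
    rw [sub_add_cancel, h0] at h1
    linarith
  have hvec : ∀ j ∈ E.index, L.starProjection (E.vec j) = K.starProjection (E.vec j) := by
    have hs : ∑ j ∈ E.index, ‖L.starProjection (E.vec j) - K.starProjection (E.vec j)‖ ^ 2 ≤ 0 := by
      simp only [trace, hnorm, hpyth, Finset.sum_add_distrib] at h
      linarith
    intro j hj
    have h1 := (Finset.sum_eq_zero_iff_of_nonneg fun j _ => sq_nonneg _).1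
      (hs.antisymm (Finset.sum_nonneg fun j _ => sq_nonneg _)) j hj
    rw [sq_eq_zero_iff, norm_eq_zero] at h1
    exact sub_eq_zero.1 h1
  intro z hz
  rw [← Submodule.starProjection_eq_self_iff, ← sub_eq_zero]
  refine E.eq_zero_of_inner_eq_zero fun g j hj => ?_
  have hz' : L.starProjection z = z := Submodule.starProjection_eq_self_iff.2 hz
  rw [inner_sub_left, K.inner_starProjection_left_eq_right, IsEquivariant.starProjection hK,
    ← hvec j hj, ← IsEquivariant.starProjection hL, ← L.inner_starProjection_left_eq_right,
    hz', sub_self]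

theorem eq_bot_of_disjoint_range (E : ParsevalFrame U ι) (E' : ParsevalFrame U' ι')
    {f : H →L[ℝ] H'} (hf : IsEquivariant U U' f) {K : Submodule ℝ H'}
    [K.HasOrthogonalProjection] (hK : ∀ g, ∀ x ∈ K, U' g x ∈ K)
    (hKf : ∀ x, f x ∈ K → f x = 0) (hcl : K ≤ (adjoint f).kerᗮ) : K = ⊥ := by
  wlog hf1 : ‖f‖ ≤ 1 generalizing f
  · have hc : (‖f‖⁻¹ : ℝ) ≠ 0 := by
      refine inv_ne_zero fun h => hf1 (h.le.trans zero_le_one)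
    refine this (f := ‖f‖⁻¹ • f) (fun g x => by simp [hf g x]) (fun x hx => ?_) ?_ ?_
    · have := (K.smul_mem_iff hc).1 hx
      simp [hKf x this]
    · refine hcl.trans (Submodule.orthogonal_le fun x hx => ?_)
      have : ‖f‖⁻¹ • adjoint f x = 0 := by simpa using hx
      exact (smul_eq_zero.1 this).resolve_left hc
    · rw [norm_smul, norm_inv, norm_norm]
      exact inv_mul_le_one
  set f' : H →L[ℝ] H' := (1 - K.starProjection) ∘L f with hf'
  have hf'eq : IsEquivariant U U' f' := by
    intro g x
    simp [hf', hf g x, IsEquivariant.starProjection hK g (f x)]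
  have hf'1 : ‖f'‖ ≤ 1 := by
    refine (opNorm_comp_le _ _).trans (mul_le_one₀ ?_ (norm_nonneg _) hf1)
    have : (1 : H' →L[ℝ] H') - K.starProjection = Kᗮ.starProjection := by
      ext x
      exact (K.starProjection_orthogonal_val x).symm
    rw [this]
    exact Submodule.starProjection_norm_le _
  have hker : f'.ker = f.ker := by
    ext x
    change f x - K.starProjection (f x) = 0 ↔ f x = 0
    refine ⟨fun h => hKf x ?_, fun h => by rw [h, map_zero, sub_zero]⟩
    rw [sub_eq_zero.1 h]
    exact K.starProjection_apply_mem _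
  have hadj : ∀ x, adjoint f' x = adjoint f (x - K.starProjection x) := by
    intro x
    refine ext_inner_right ℝ fun y => ?_
    rw [adjoint_inner_left, adjoint_inner_left]
    change inner ℝ x (f y - K.starProjection (f y)) = _
    rw [inner_sub_left, inner_sub_right, K.inner_starProjection_left_eq_right]
  have hperp : ∀ x ∈ (adjoint f).ker, K.starProjection x = 0 := by
    intro x hx
    rw [Submodule.starProjection_apply_eq_zero_iff]
    exact fun y hy => Submodule.inner_left_of_mem_orthogonal hx (hcl hy)
  have hle : (adjoint f).ker ≤ (adjoint f').ker := by
    intro x hx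
    change adjoint f' x = 0
    rw [hadj, hperp x hx, sub_zero]
    exact hx
  have hinv : ∀ {f : H →L[ℝ] H'}, IsEquivariant U U' f →
      ∀ g, ∀ x ∈ (adjoint f).ker, U' g x ∈ (adjoint f).ker := by
    intro f hf g x hx
    change adjoint f (U' g x) = 0
    rw [hf.adjoint g x, show adjoint f x = 0 from hx, map_zero]
  have htr : E'.trace (adjoint f').ker.starProjection ≤
      E'.trace (adjoint f).ker.starProjection := by
    have h1 := E.trace_starProjection_ker E' hf hf1
    have h2 := E.trace_starProjection_ker E' hf'eq hf'1
    have h3 : f'.ker.starProjection = f.ker.starProjection :=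
      Submodule.starProjection_inj.2 hker
    rw [h3] at h2
    linarith
  have hge := E'.le_of_trace_starProjection_le (hinv hf) (hinv hf'eq) hle htr
  rw [eq_bot_iff]
  intro x hx
  have hx' : x ∈ (adjoint f').ker := by
    change adjoint f' x = 0
    rw [hadj, Submodule.starProjection_eq_self_iff.2 hx, sub_self, map_zero]
  rw [← Submodule.starProjection_eq_self_iff.2 hx]
  exact hperp x (hge hx')

/-- A closed invariant subspace in the closure of the range of an equivariant operator is the
closure of its intersection with the range. -/
theorem inf_closure_range_le (E : ParsevalFrame U ι) (E' : ParsevalFrame U' ι')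
    {f : H →L[ℝ] H'} (hf : IsEquivariant U U' f) {N : Submodule ℝ H'}
    (hN : ∀ g, ∀ x ∈ N, U' g x ∈ N) (hNc : IsClosed (N : Set H')) :
    N ⊓ f.range.topologicalClosure ≤ (N ⊓ f.range).topologicalClosure := by
  set R := f.range with hR
  have hRinv : ∀ g, ∀ x ∈ R, U' g x ∈ R := by
    rintro g _ ⟨x, rfl⟩
    exact ⟨U g x, hf g x⟩
  have hRc : R.topologicalClosure = (adjoint f).kerᗮ := by
    rw [ContinuousLinearMap.orthogonal_ker, adjoint_adjoint]
  have hRcinv : ∀ g, ∀ x ∈ R.topologicalClosure, U' g x ∈ R.topologicalClosure := by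
    intro g x hx
    exact map_mem_closure (U' g).continuous hx (hRinv g)
  set K : Submodule ℝ H' := N ⊓ R.topologicalClosure ⊓ (N ⊓ R)ᗮ with hKdef
  have hKc : IsClosed (K : Set H') :=
    (hNc.inter R.isClosed_topologicalClosure).inter (Submodule.isClosed_orthogonal _)
  have : CompleteSpace K := hKc.completeSpace_coe
  have hKinv : ∀ g, ∀ x ∈ K, U' g x ∈ K := by
    intro g x hx
    refine ⟨⟨hN g x hx.1.1, hRcinv g x hx.1.2⟩, fun y hy => ?_⟩
    rw [inner_unitary_right]
    exact hx.2 _ ⟨hN _ _ hy.1, hRinv _ _ hy.2⟩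
  have hK0 : K = ⊥ := by
    refine E.eq_bot_of_disjoint_range E' hf hKinv (fun x hx => ?_) ?_
    · exact inner_self_eq_zero.1 (hx.2 (f x) ⟨hx.1.1, ⟨x, rfl⟩⟩)
    · rw [← hRc]
      exact fun x hx => hx.1.2
  intro z hz
  set L := (N ⊓ R).topologicalClosure with hL
  have hLc : CompleteSpace L := (N ⊓ R).isClosed_topologicalClosure.completeSpace_coe
  have hLle : L ≤ N ⊓ R.topologicalClosure :=
    Submodule.topologicalClosure_minimal _ (inf_le_inf_left _ R.le_topologicalClosure)
      (hNc.inter R.isClosed_topologicalClosure)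
  have hd : z - L.starProjection z ∈ K := by
    refine ⟨sub_mem hz (hLle (L.starProjection_apply_mem z)), ?_⟩
    exact Submodule.orthogonal_le (Submodule.le_topologicalClosure _)
      (L.sub_starProjection_mem_orthogonal z)
  rw [hK0, Submodule.mem_bot, sub_eq_zero] at hd
  rw [hd]
  exact L.starProjection_apply_mem z

end ParsevalFrame

end EquivariantHilbert

/-! ## Operators between `ℓ²`-spaces induced by maps of the index sets -/

namespace L2

/-- The real Hilbert space with orthonormal basis `X`. -/
abbrev Space (X : Type*) : Type _ := lp (fun _ : X => ℝ) 2

variable {X Y : Type*}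

/-- The fibres of `φ` are uniformly finite. -/
def BoundedFibers (φ : X → Y) : Prop :=
  ∃ N : ℕ, ∀ y, ∀ s : Finset X, (∀ x ∈ s, φ x = y) → s.card ≤ N

theorem boundedFibers_of_injective {φ : X → Y} (h : Function.Injective φ) : BoundedFibers φ :=
  ⟨1, fun _ _ hs => Finset.card_le_one.2 fun a ha b hb => h ((hs a ha).trans (hs b hb).symm)⟩

theorem BoundedFibers.exists_sum_le {φ : X → Y} (hφ : BoundedFibers φ) :
    ∃ C : ℝ, 0 ≤ C ∧ ∀ (g : Space Y) (s : Finset X),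
      ∑ x ∈ s, ‖g (φ x)‖ ^ (2 : ENNReal).toReal ≤ (C * ‖g‖) ^ (2 : ENNReal).toReal := by
  classical
  obtain ⟨N, hN⟩ := hφ
  refine ⟨Real.sqrt N, Real.sqrt_nonneg _, fun g s => ?_⟩
  have h2 : 0 < (2 : ENNReal).toReal := by norm_num
  have h3 : (Real.sqrt N * ‖g‖) ^ (2 : ENNReal).toReal = N * ‖g‖ ^ (2 : ENNReal).toReal := by
    rw [Real.mul_rpow (Real.sqrt_nonneg _) (norm_nonneg _)]
    congr 1
    simp
  rw [h3, Finset.sum_comp (fun y => ‖g y‖ ^ (2 : ENNReal).toReal) φ]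
  refine le_trans ?_ (mul_le_mul_of_nonneg_left
    (lp.sum_rpow_le_norm_rpow h2 g (s.image φ)) (Nat.cast_nonneg N))
  rw [Finset.mul_sum]
  refine Finset.sum_le_sum fun y _ => ?_
  rw [nsmul_eq_mul]
  refine mul_le_mul_of_nonneg_right ?_ (by positivity)
  exact_mod_cast hN y _ fun x hx => (Finset.mem_filter.1 hx).2

/-- Composition with a map with uniformly finite fibres. -/
noncomputable def pullback (φ : X → Y) (hφ : BoundedFibers φ) : Space Y →L[ℝ] Space X :=
  LinearMap.mkContinuousOfExistsBound
    { toFun := fun g => ⟨fun x => g (φ x), by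
        obtain ⟨C, _, h⟩ := hφ.exists_sum_le
        exact memℓp_gen' (h g)⟩
      map_add' := fun f g => rfl
      map_smul' := fun c g => rfl }
    (by
      obtain ⟨C, hC, h⟩ := hφ.exists_sum_le
      exact ⟨C, fun g => lp.norm_le_of_forall_sum_le (by norm_num) (by positivity) (h g)⟩)

theorem pullback_apply (φ : X → Y) (hφ : BoundedFibers φ) (g : Space Y) (x : X) :
    pullback φ hφ g x = g (φ x) := rfl

/-- Restriction of functions to a subset. -/
noncomputable def restrictTo (p : X → Prop) : Space X →L[ℝ] Space {x // p x} :=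
  pullback Subtype.val (boundedFibers_of_injective Subtype.val_injective)

theorem restrictTo_apply (p : X → Prop) (f : Space X) (x : {x // p x}) :
    restrictTo p f x = f x.1 := rfl

/-- Extension of functions by zero. -/
noncomputable def zeroExtend (p : X → Prop) : Space {x // p x} →L[ℝ] Space X :=
  adjoint (restrictTo p)

theorem apply_eq_inner_single [DecidableEq X] (f : Space X) (x : X) :
    f x = inner ℝ (lp.single 2 x (1 : ℝ) : Space X) f := by
  rw [lp.inner_single_left]
  simp

open Classical in
theorem zeroExtend_apply (p : X → Prop) (f : Space {x // p x}) (x : X) :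
    zeroExtend p f x = if h : p x then f ⟨x, h⟩ else 0 := by
  rw [apply_eq_inner_single, zeroExtend, adjoint_inner_right]
  split_ifs with h
  · rw [apply_eq_inner_single f]
    congr 1
    ext y
    rw [restrictTo_apply, lp.single_apply, lp.single_apply, Pi.single_apply, Pi.single_apply]
    simp [Subtype.ext_iff]
  · have : restrictTo p (lp.single 2 x (1 : ℝ) : Space X) = 0 := by
      ext y
      rw [restrictTo_apply, lp.single_apply, Pi.single_apply, if_neg]
      · rfl
      · rintro rfl
        exact h y.2
    rw [this, inner_zero_left]

theorem restrictTo_zeroExtend (p : X → Prop) (f : Space {x // p x}) : restrictTo p (zeroExtend p f) = f := by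
  ext x
  rw [restrictTo_apply, zeroExtend_apply, dif_pos x.2]

/-- The orthogonal suppProjection to the functions supported on a subset. -/
noncomputable def suppProj (p : X → Prop) : Space X →L[ℝ] Space X := zeroExtend p ∘L restrictTo p

open Classical in
theorem suppProj_apply (p : X → Prop) (f : Space X) (x : X) :
    suppProj p f x = if p x then f x else 0 := by
  rw [suppProj, comp_apply, zeroExtend_apply]
  rfl

theorem adjoint_suppProj (p : X → Prop) : adjoint (suppProj p) = suppProj p := by
  rw [suppProj, adjoint_comp, zeroExtend, adjoint_adjoint]

theorem suppProj_zeroExtend (p : X → Prop) (f : Space {x // p x}) : suppProj p (zeroExtend p f) = zeroExtend p f := by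
  rw [suppProj, comp_apply, restrictTo_zeroExtend]

theorem restrictTo_suppProj (p : X → Prop) (f : Space X) : restrictTo p (suppProj p f) = restrictTo p f := by
  rw [suppProj, comp_apply, restrictTo_zeroExtend]

theorem suppProj_suppProj (p : X → Prop) (f : Space X) : suppProj p (suppProj p f) = suppProj p f :=
  suppProj_zeroExtend p _

/-- The functions supported on a subset. -/
noncomputable def supportedOn (p : X → Prop) : Submodule ℝ (Space X) :=
  (ContinuousLinearMap.id ℝ (Space X) - suppProj p).ker

theorem mem_supportedOn {p : X → Prop} {f : Space X} : f ∈ supportedOn p ↔ suppProj p f = f :=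
  sub_eq_zero.trans eq_comm

theorem isClosed_supportedOn (p : X → Prop) : IsClosed (supportedOn p : Set (Space X)) :=
  ContinuousLinearMap.isClosed_ker _

theorem suppProj_suppProj_of_imp {p q : X → Prop} (h : ∀ x, p x → q x) (f : Space X) :
    suppProj q (suppProj p f) = suppProj p f := by
  ext x
  simp only [suppProj_apply]
  grind

theorem suppProj_suppProj_of_le {p q : X → Prop} (h : ∀ x, p x → q x) (f : Space X) :
    suppProj p (suppProj q f) = suppProj p f := by
  ext x
  simp only [suppProj_apply]
  grind

theorem suppProj_suppProj_of_disjoint {p q : X → Prop} (h : ∀ x, p x → ¬ q x) (f : Space X) :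
    suppProj q (suppProj p f) = 0 := by
  ext x
  simp only [suppProj_apply, lp.coeFn_zero, Pi.zero_apply]
  grind

theorem suppProj_eq_add {p q r : X → Prop} (h : ∀ x, r x ↔ p x ∨ q x) (h' : ∀ x, p x → ¬ q x)
    (f : Space X) : suppProj r f = suppProj p f + suppProj q f := by
  ext x
  simp only [suppProj_apply, lp.coeFn_add, Pi.add_apply]
  grind

end L2

/-! ## The boundary operator on square-summable chains -/

namespace OrderComplex

open L2

/-- Every simplex is a face of a uniformly bounded number of simplices. -/
class HasBoundedCofaces (P : Type*) [PartialOrder P] : Prop where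
  boundedFibers : ∀ (i : ℕ) (j : Fin (i + 2)),
    BoundedFibers (fun σ : Simplex P (i + 1) => face σ j)

variable {P : Type*} [PartialOrder P]

section

variable [HasBoundedCofaces P]

/-- The coboundary operator on square-summable cochains. -/
noncomputable def coboundary (P : Type*) [PartialOrder P] [HasBoundedCofaces P] (i : ℕ) :
    Space (Simplex P i) →L[ℝ] Space (Simplex P (i + 1)) :=
  ∑ j : Fin (i + 2), (-1 : ℝ) ^ (j : ℕ) •
    pullback (fun σ : Simplex P (i + 1) => face σ j) (HasBoundedCofaces.boundedFibers i j)

theorem coboundary_apply {i : ℕ} (g : Space (Simplex P i)) (σ : Simplex P (i + 1)) :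
    coboundary P i g σ = ∑ j : Fin (i + 2), (-1 : ℝ) ^ (j : ℕ) * g (face σ j) := by
  rw [coboundary, sum_apply, lp.coeFn_sum, Finset.sum_apply]
  rfl

theorem face_face {i : ℕ} (σ : Simplex P (i + 2)) {j : Fin (i + 3)} {k : Fin (i + 2)}
    (h : (j : ℕ) ≤ k) : face (face σ j) k =
      face (face σ k.succ) (j.castLT (lt_of_le_of_lt h k.is_lt)) := by
  ext l
  change σ (j.succAbove (k.succAbove l)) = σ (k.succ.succAbove ((j.castLT _).succAbove l))
  congr 1
  have hl := l.is_lt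
  ext
  simp only [Fin.succAbove, Fin.lt_def]
  split_ifs <;> simp_all <;> omega

theorem coboundary_coboundary {i : ℕ} (g : Space (Simplex P i)) :
    coboundary P (i + 1) (coboundary P i g) = 0 := by
  ext σ
  rw [coboundary_apply, lp.coeFn_zero, Pi.zero_apply]
  simp only [coboundary_apply, Finset.mul_sum, ← Finset.sum_product', Finset.univ_product_univ]
  let S : Finset (Fin (i + 3) × Fin (i + 2)) := {jk | (jk.1 : ℕ) ≤ (jk.2 : ℕ)}
  rw [← Finset.sum_add_sum_compl S, ← eq_neg_iff_add_eq_zero, ← Finset.sum_neg_distrib]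
  refine Finset.sum_bij (fun jk hjk => (jk.2.succ, jk.1.castLT (lt_of_le_of_lt
    (Finset.mem_filter.mp hjk).right jk.2.is_lt))) ?_ ?_ ?_ ?_
  · rintro ⟨j, k⟩ h
    simp only [S, Finset.compl_filter, Finset.mem_filter_univ, Fin.val_succ,
      Fin.val_castLT] at h ⊢
    omega
  · rintro ⟨j, k⟩ _ ⟨j', k'⟩ _ h
    simp only [Prod.mk.injEq, Fin.ext_iff, Fin.val_succ, Fin.val_castLT] at h ⊢
    omega
  · rintro ⟨j, k⟩ h
    simp only [S, Finset.compl_filter, Finset.mem_filter_univ, not_le] at h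
    refine ⟨(k.castSucc, j.pred (by rintro rfl; simp at h)), ?_, ?_⟩
    · simp only [S, Finset.mem_filter_univ, Fin.val_castSucc, Fin.val_pred]
      omega
    · simp
  · rintro ⟨j, k⟩ h
    have h' : (j : ℕ) ≤ k := (Finset.mem_filter.mp h).right
    simp only [face_face σ h', Fin.val_succ, Fin.val_castLT, pow_succ]
    ring

/-- The boundary operator on square-summable chains. -/
noncomputable def boundary (P : Type*) [PartialOrder P] [HasBoundedCofaces P] (i : ℕ) :
    Space (Simplex P (i + 1)) →L[ℝ] Space (Simplex P i) :=
  adjoint (coboundary P i)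

theorem suppProj_boundary_suppProj_eq_zero {i : ℕ} {p : Simplex P (i + 1) → Prop} {q : Simplex P i → Prop}
    (h : ∀ σ, p σ → ∀ j, ¬ q (face σ j)) (x : Space (Simplex P (i + 1))) :
    suppProj q (boundary P i (suppProj p x)) = 0 := by
  refine ext_inner_right ℝ fun y => ?_
  rw [← adjoint_inner_right, adjoint_suppProj, boundary, adjoint_inner_left, ← adjoint_inner_right,
    adjoint_suppProj, inner_zero_left]
  have : suppProj p (coboundary P i (suppProj q y)) = 0 := by
    ext σ
    rw [suppProj_apply, lp.coeFn_zero, Pi.zero_apply]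
    split_ifs with hσ
    · rw [coboundary_apply]
      refine Finset.sum_eq_zero fun j _ => ?_
      rw [suppProj_apply, if_neg (h σ hσ j), mul_zero]
    · rfl
  rw [this, inner_zero_right]

theorem suppProj_boundary_suppProj_boundary_suppProj_eq_zero {i : ℕ} {p : Simplex P (i + 2) → Prop}
    {q : Simplex P (i + 1) → Prop} {r : Simplex P i → Prop}
    (h : ∀ σ, p σ → ∀ j k, r (face (face σ j) k) → q (face σ j))
    (x : Space (Simplex P (i + 2))) :
    suppProj r (boundary P i (suppProj q (boundary P (i + 1) (suppProj p x)))) = 0 := by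
  refine ext_inner_right ℝ fun y => ?_
  simp only [boundary]
  rw [← adjoint_inner_right, adjoint_suppProj, adjoint_inner_left, ← adjoint_inner_right,
    adjoint_suppProj, adjoint_inner_left, ← adjoint_inner_right, adjoint_suppProj, inner_zero_left]
  have : suppProj p (coboundary P (i + 1) (suppProj q (coboundary P i (suppProj r y)))) = 0 := by
    ext σ
    rw [suppProj_apply, lp.coeFn_zero, Pi.zero_apply]
    split_ifs with hσ
    · have h0 : coboundary P (i + 1) (coboundary P i (suppProj r y)) σ = 0 := by
        rw [coboundary_coboundary]
        rfl
      rw [← h0, coboundary_apply, coboundary_apply]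
      refine Finset.sum_congr rfl fun j _ => ?_
      rw [suppProj_apply]
      split_ifs with hj
      · rfl
      · rw [coboundary_apply, Finset.sum_eq_zero]
        intro k _
        rw [suppProj_apply, if_neg fun hr => hj (h σ hσ j k hr), mul_zero]
    · rfl
  rw [this, inner_zero_right]

/-- Vanishing of the reduced `ℓ²`-homology in degree `i + 1` of the chains on the simplices which
satisfy `p`. -/
def ReducedVanishes (p : ∀ i, Simplex P i → Prop) (i : ℕ) : Prop :=
  ∀ z : Space (Simplex P (i + 1)), suppProj (p (i + 1)) z = z → suppProj (p i) (boundary P i z) = 0 →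
    z ∈ (suppProj (p (i + 1)) ∘L boundary P (i + 1) ∘L suppProj (p (i + 2))).range.topologicalClosure

theorem relBoundary_eq [IsLocallyFinite P] (X Y : Subcomplex P) (i : ℕ)
    (f : L2Chains X Y (i + 1)) : relBoundary X Y i f =
      restrictTo (fun σ => σ ∈ X.simplices i ∧ σ ∉ Y.simplices i) (boundary P i
        (zeroExtend (fun σ => σ ∈ X.simplices (i + 1) ∧ σ ∉ Y.simplices (i + 1)) f)) := by
  classical
  funext τ
  rw [restrictTo_apply, apply_eq_inner_single, boundary, adjoint_inner_right, zeroExtend,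
    adjoint_inner_right, lp.inner_eq_tsum]
  have h : ∀ σ : RelSimplex X Y (i + 1), incidence σ.1 τ.1 * f σ =
      inner ℝ (restrictTo (fun σ => σ ∈ X.simplices (i + 1) ∧ σ ∉ Y.simplices (i + 1))
        (coboundary P i (lp.single 2 τ.1 (1 : ℝ) : Space (Simplex P i))) σ) (f σ) := by
    intro σ
    rw [restrictTo_apply, coboundary_apply]
    change _ = f σ * _
    rw [mul_comm, incidence]
    congr 1
    refine Finset.sum_congr rfl fun j _ => ?_
    rw [lp.single_apply, Pi.single_apply]
    simp
  change ∑ᶠ σ : RelSimplex X Y (i + 1), incidence σ.1 τ.1 * f σ = _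
  simp only [← h]
  exact (tsum_eq_finsum (finite_support_incidence f τ)).symm

theorem subsingleton_reducedL2Homology_iff [IsLocallyFinite P] (X Y : Subcomplex P) (i : ℕ) :
    Subsingleton (ReducedL2Homology X Y (i + 1)) ↔
      ReducedVanishes (fun i σ => σ ∈ X.simplices i ∧ σ ∉ Y.simplices i) i := by
  rw [Submodule.Quotient.subsingleton_iff, Submodule.comap_subtype_eq_top]
  set p : ∀ i, Simplex P i → Prop := fun i σ => σ ∈ X.simplices i ∧ σ ∉ Y.simplices i
  have hcyc : ∀ z : L2Chains X Y (i + 1), z ∈ l2Cycles X Y (i + 1) ↔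
      restrictTo (p i) (boundary P i (zeroExtend (p (i + 1)) z)) = 0 := by
    intro z
    change relBoundary X Y i z = 0 ↔ _
    rw [relBoundary_eq]
    exact ⟨fun h => lp.ext h, fun h =>
      congrArg (fun f : L2Chains X Y i => (f : RelSimplex X Y i → ℝ)) h⟩
  have hbd : l2Boundaries X Y (i + 1) =
      (restrictTo (p (i + 1)) ∘L boundary P (i + 1) ∘L zeroExtend (p (i + 2))).range := by
    ext b
    constructor
    · rintro ⟨c, hc⟩
      rw [relBoundary_eq] at hc
      exact ⟨c, lp.ext hc⟩
    · rintro ⟨c, rfl⟩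
      exact ⟨c, relBoundary_eq X Y (i + 1) c⟩
  rw [hbd]
  constructor
  · intro h z hz hdz
    have hz' : restrictTo (p (i + 1)) z ∈ l2Cycles X Y (i + 1) := by
      rw [hcyc]
      change restrictTo (p i) (boundary P i (suppProj (p (i + 1)) z)) = 0
      rw [hz, ← restrictTo_suppProj, hdz, map_zero]
    have := map_mem_closure (zeroExtend (p (i + 1))).continuous (h hz')
      (t := ((suppProj (p (i + 1)) ∘L boundary P (i + 1) ∘L suppProj (p (i + 2))).range : Set _)) ?_
    · rw [← hz]
      exact this
    · rintro _ ⟨c, rfl⟩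
      exact ⟨zeroExtend (p (i + 2)) c, by simp [suppProj_zeroExtend]; rfl⟩
  · intro h z hz
    rw [hcyc] at hz
    have h1 := h (zeroExtend (p (i + 1)) z) (suppProj_zeroExtend _ _) (by
      rw [suppProj, comp_apply, hz, map_zero])
    have := map_mem_closure (restrictTo (p (i + 1))).continuous h1
      (t := ((restrictTo (p (i + 1)) ∘L boundary P (i + 1) ∘L zeroExtend (p (i + 2))).range : Set _)) ?_
    · rw [restrictTo_zeroExtend] at this
      exact this
    · rintro _ ⟨c, rfl⟩
      exact ⟨restrictTo (p (i + 2)) c, by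
        change _ = restrictTo (p (i + 1)) (suppProj (p (i + 1)) (boundary P (i + 1) _))
        rw [restrictTo_suppProj]
        rfl⟩

/-- The exactness argument: `C` is the disjoint union of the subcomplex `A` and its complement
`D`. -/
theorem ReducedVanishes.of_disjoint_union {A C D : ∀ i, Simplex P i → Prop}
    (hC : ∀ i σ, C i σ ↔ A i σ ∨ D i σ) (hdisj : ∀ i σ, A i σ → ¬ D i σ)
    (hface : ∀ i σ j, A (i + 1) σ → ¬ D i (face σ j))
    (hmid : ∀ i σ j k, D (i + 2) σ → A i (face (face σ j) k) → C (i + 1) (face σ j)) {i : ℕ}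
    (hdense : supportedOn (A (i + 1)) ⊓
        (suppProj (C (i + 1)) ∘L boundary P (i + 1) ∘L suppProj (C (i + 2))).range.topologicalClosure ≤
      (supportedOn (A (i + 1)) ⊓
        (suppProj (C (i + 1)) ∘L boundary P (i + 1) ∘L suppProj (C (i + 2))).range).topologicalClosure)
    (hvC : ReducedVanishes C i) (hvD : ReducedVanishes D (i + 1)) : ReducedVanishes A i := by
  intro z hz hdz
  have hadd : ∀ i x, suppProj (C i) x = suppProj (A i) x + suppProj (D i) x := fun i x =>
    suppProj_eq_add (hC i) (hdisj i) x
  have hAC : ∀ σ, A (i + 1) σ → C (i + 1) σ := fun σ hσ => (hC _ σ).2 (Or.inl hσ)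
  have hDC : ∀ σ, D (i + 1) σ → C (i + 1) σ := fun σ hσ => (hC _ σ).2 (Or.inr hσ)
  have hDA : ∀ i x, suppProj (D i) (boundary P i (suppProj (A (i + 1)) x)) = 0 := fun i x =>
    suppProj_boundary_suppProj_eq_zero (fun σ hσ j => hface i σ j hσ) x
  have hCz : suppProj (C (i + 1)) z = z := by
    rw [← hz]
    exact suppProj_suppProj_of_imp hAC z
  have hCdz : suppProj (C i) (boundary P i z) = 0 := by
    rw [hadd, hdz, zero_add, ← hz, hDA]
  have hz1 := hdense ⟨mem_supportedOn.2 hz, hvC z hCz hCdz⟩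
  set BA := (suppProj (A (i + 1)) ∘L boundary P (i + 1) ∘L suppProj (A (i + 2))).range with hBA
  refine Submodule.topologicalClosure_minimal _ ?_ BA.isClosed_topologicalClosure hz1
  rintro y ⟨hyA, e, hey⟩
  rw [SetLike.mem_coe, mem_supportedOn] at hyA
  have hey : suppProj (C (i + 1)) (boundary P (i + 1) (suppProj (C (i + 2)) e)) = y := hey
  have hyD : suppProj (D (i + 1)) y = 0 := by
    rw [← hyA]
    exact suppProj_suppProj_of_disjoint (hdisj _) y
  have h1 : suppProj (A (i + 1)) (boundary P (i + 1) (suppProj (A (i + 2)) e)) +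
      suppProj (A (i + 1)) (boundary P (i + 1) (suppProj (D (i + 2)) e)) = y := by
    rw [← map_add, ← map_add, ← hadd, ← suppProj_suppProj_of_le hAC, hey, hyA]
  have h2 : suppProj (D (i + 1)) (boundary P (i + 1) (suppProj (D (i + 2)) e)) = 0 := by
    have : suppProj (D (i + 1)) (boundary P (i + 1) (suppProj (C (i + 2)) e)) = 0 := by
      rw [← suppProj_suppProj_of_le hDC, hey, hyD]
    rwa [hadd, map_add, map_add, hDA, zero_add] at this
  have h3 := hvD (suppProj (D (i + 2)) e) (suppProj_suppProj _ _) h2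
  have h4 : (suppProj (A (i + 1)) ∘L boundary P (i + 1)) (suppProj (D (i + 2)) e) ∈
      BA.topologicalClosure := by
    refine map_mem_closure (suppProj (A (i + 1)) ∘L boundary P (i + 1)).continuous h3 ?_
    rintro _ ⟨c, rfl⟩
    have h5 := suppProj_boundary_suppProj_boundary_suppProj_eq_zero
      (fun σ hσ j k => hmid (i + 1) σ j k hσ) c
    rw [hadd, map_add, map_add] at h5
    have h6 := eq_neg_of_add_eq_zero_right h5
    refine ⟨-boundary P (i + 2) (suppProj (D (i + 3)) c), ?_⟩
    exact (map_neg (suppProj (A (i + 1)) ∘L boundary P (i + 1) ∘L suppProj (A (i + 2))) _).trans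
      h6.symm
  rw [← h1]
  exact add_mem (BA.le_topologicalClosure ⟨e, rfl⟩) h4

end

end OrderComplex

/-! ## Permutation representations -/

namespace L2

open EquivariantHilbert

variable {G X : Type*} [Group G] [MulAction G X]

/-- The operator by which a group element acts on the functions on a `G`-set. -/
noncomputable def translate (g : G) : Space X ≃ₗᵢ[ℝ] Space X where
  toFun := pullback (fun x => g⁻¹ • x) (boundedFibers_of_injective (MulAction.injective g⁻¹))
  invFun := pullback (fun x => g • x) (boundedFibers_of_injective (MulAction.injective g))
  map_add' := map_add _
  map_smul' := map_smul _
  left_inv f := by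
    ext x
    simp only [pullback_apply, inv_smul_smul]
  right_inv f := by
    ext x
    simp only [pullback_apply, smul_inv_smul]
  norm_map' f := by
    have h2 : 0 < (2 : ENNReal).toReal := by norm_num
    refine (Real.rpow_left_inj (norm_nonneg _) (norm_nonneg _) h2.ne').1 ?_
    rw [lp.norm_rpow_eq_tsum h2, lp.norm_rpow_eq_tsum h2]
    exact (MulAction.toPerm g⁻¹ : Equiv.Perm X).tsum_eq fun x => ‖f x‖ ^ (2 : ENNReal).toReal

theorem translate_apply (g : G) (f : Space X) (x : X) : translate g f x = f (g⁻¹ • x) := rfl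

/-- The unitary representation of `G` on the functions on a `G`-set. -/
noncomputable def permRep (G X : Type*) [Group G] [MulAction G X] :
    G →* (Space X ≃ₗᵢ[ℝ] Space X) where
  toFun := translate
  map_one' := by
    ext f x
    rw [translate_apply, inv_one, one_smul]
    rfl
  map_mul' g h := by
    ext f x
    rw [translate_apply, mul_inv_rev, mul_smul]
    rfl

theorem permRep_apply (g : G) (f : Space X) (x : X) : permRep G X g f x = f (g⁻¹ • x) := rfl

theorem isEquivariant_suppProj {p : X → Prop} (hp : ∀ (g : G) x, p (g • x) ↔ p x) :
    IsEquivariant (permRep G X) (permRep G X) (suppProj p) := by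
  intro g f
  ext x
  have h : p (g⁻¹ • x) ↔ p x := hp g⁻¹ x
  by_cases hx : p x <;> simp [suppProj_apply, permRep_apply, h, hx]

theorem hasSum_sq (f : Space X) : HasSum (fun x => f x ^ 2) (‖f‖ ^ 2) := by
  have h := lp.hasSum_inner (𝕜 := ℝ) f f
  rw [real_inner_self_eq_norm_sq] at h
  have e : (fun x => f x ^ 2) = fun x => inner ℝ (f x) (f x) := funext fun x => sq (f x)
  rwa [e]

open Classical in
/-- The frame given by a finitely supported weight function whose translates sum to one. -/
noncomputable def weightFrame (w : X → ℝ) (F : Finset X) (hw : ∀ x, 0 ≤ w x)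
    (hF : ∀ x ∉ F, w x = 0) (hsum : ∀ x, HasSum (fun g : G => w (g⁻¹ • x)) 1) :
    ParsevalFrame (permRep G X) X where
  index := F
  vec x := Real.sqrt (w x) • lp.single 2 x (1 : ℝ)
  hasSum_norm_sq f := by
    have hterm : ∀ (g : G) (x : X),
        (inner ℝ f (permRep G X g (Real.sqrt (w x) • lp.single 2 x (1 : ℝ)))) ^ 2 =
          w x * f (g • x) ^ 2 := by
      intro g x
      rw [inner_unitary_right, inner_smul_right, real_inner_comm, ← apply_eq_inner_single,
        permRep_apply, inv_inv, mul_pow, Real.sq_sqrt (hw x)]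
    simp only [hterm]
    set k : X × G → ℝ := fun q => w (q.2⁻¹ • q.1) * f q.1 ^ 2 with hk
    have hfib : ∀ x, HasSum (fun g => k (x, g)) (f x ^ 2) := fun x => by
      simpa using (hsum x).mul_right (f x ^ 2)
    have hsummable : Summable k := by
      refine (summable_prod_of_nonneg fun q => mul_nonneg (hw _) (sq_nonneg _)).2
        ⟨fun x => (hfib x).summable, ?_⟩
      have e : (fun x => ∑' g, k (x, g)) = fun x => f x ^ 2 := funext fun x => (hfib x).tsum_eq
      rw [e]
      exact (hasSum_sq f).summable
    have htot : HasSum k (‖f‖ ^ 2) := by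
      have h := hsummable.hasSum
      rwa [(h.prod_fiberwise hfib).unique (hasSum_sq f)] at h
    refine ((Equiv.prodComm G X).hasSum_iff.2 htot).prod_fiberwise fun g => ?_
    refine ((MulAction.toPerm g : Equiv.Perm X).hasSum_iff).1 ?_
    have : ((fun x => (k ∘ Equiv.prodComm G X) (g, x)) ∘ (MulAction.toPerm g : Equiv.Perm X)) =
        fun x => w x * f (g • x) ^ 2 := by
      funext x
      simp [hk]
    rw [this]
    exact hasSum_sum_of_ne_finset_zero fun x hx => by rw [hF x hx, zero_mul]

end L2

namespace OrderComplex

open L2 EquivariantHilbert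

theorem isEquivariant_boundary {P G : Type*} [PartialOrder P] [HasBoundedCofaces P] [Group G]
    [∀ i, MulAction G (Simplex P i)]
    (h : ∀ (g : G) (i : ℕ) (σ : Simplex P (i + 1)) j, face (g • σ) j = g • face σ j) (i : ℕ) :
    IsEquivariant (permRep G (Simplex P (i + 1))) (permRep G (Simplex P i)) (boundary P i) := by
  refine IsEquivariant.adjoint fun g f => ?_
  ext σ
  simp only [coboundary_apply, permRep_apply, h]

end OrderComplex

/-! ## The action of the Coxeter group on the Davis complex -/

namespace Davis

open OrderComplex L2 EquivariantHilbert

variable {B : Type u} {W : Type v} [Group W] {M : CoxeterMatrix B} {cs : CoxeterSystem M W}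

namespace SphericalCoset

theorem le_cellType {c d : SphericalCoset cs} (h : c ≤ d) : c.cellType ⊆ d.cellType :=
  cellType_subset_of_carrier_subset h

/-- Left translation of spherical cosets. -/
def translate (g : W) (c : SphericalCoset cs) : SphericalCoset cs where
  carrier := (fun x => g * x) '' c.carrier
  cellType := c.cellType
  spherical := c.spherical
  exists_eq_coset := by
    obtain ⟨w, hw⟩ := c.exists_eq_coset
    refine ⟨g * w, ?_⟩
    rw [hw, Set.image_image]
    simp only [mul_assoc]

instance : MulAction W (SphericalCoset cs) where
  smul := translate
  one_smul c := carrier_injective cs (by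
    change (fun x => 1 * x) '' c.carrier = _
    simp)
  mul_smul g h c := carrier_injective cs (by
    change (fun x => g * h * x) '' c.carrier = (fun x => g * x) '' ((fun x => h * x) '' c.carrier)
    rw [Set.image_image]
    simp only [mul_assoc])

theorem smul_carrier (g : W) (c : SphericalCoset cs) :
    (g • c).carrier = (fun x => g * x) '' c.carrier := rfl

theorem smul_le_smul_iff (g : W) (c d : SphericalCoset cs) : g • c ≤ g • d ↔ c ≤ d :=
  Set.image_subset_image_iff (mul_right_injective g)

theorem one_mem_inv_smul_iff (g : W) (c : SphericalCoset cs) :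
    1 ∈ (g⁻¹ • c).carrier ↔ g ∈ c.carrier := by
  rw [smul_carrier]
  constructor
  · rintro ⟨x, hx, h⟩
    rwa [← inv_mul_eq_one.1 h] at hx
  · exact fun h => ⟨g, h, inv_mul_cancel g⟩

/-- The union of the spherical parabolic subgroups. -/
def sphericalUnion (cs : CoxeterSystem M W) : Set W :=
  ⋃ T ∈ {T : Set B | IsSpherical cs T}, (parabolic cs T : Set W)

theorem finite_sphericalUnion [Finite B] (cs : CoxeterSystem M W) : (sphericalUnion cs).Finite := by
  refine Set.Finite.biUnion (Set.toFinite _) fun T hT => ?_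
  have : Finite (parabolic cs T) := hT
  exact Set.toFinite (parabolic cs T : Set W)

theorem inv_mul_mem_sphericalUnion {c d : SphericalCoset cs} (h : c ≤ d ∨ d ≤ c) {w x : W}
    (hw : w ∈ d.carrier) (hx : x ∈ c.carrier) : w⁻¹ * x ∈ sphericalUnion cs := by
  have key : ∀ e : SphericalCoset cs, w ∈ e.carrier → x ∈ e.carrier →
      w⁻¹ * x ∈ sphericalUnion cs := by
    intro e hwe hxe
    rw [e.carrier_eq_of_mem hwe] at hxe
    obtain ⟨p, hp, rfl⟩ := hxe
    rw [inv_mul_cancel_left]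
    exact Set.mem_biUnion (show e.cellType ∈ {T : Set B | IsSpherical cs T} from e.spherical) hp
  rcases h with h | h
  · exact key d hw (h hx)
  · exact key c (h hw) hx

instance [Finite B] : HasBoundedCofaces (SphericalCoset cs) where
  boundedFibers i j := by
    classical
    have : Finite (sphericalUnion cs) := finite_sphericalUnion cs
    have : Fintype (Fin (i + 2) → Set (sphericalUnion cs)) := Fintype.ofFinite _
    refine ⟨Fintype.card (Fin (i + 2) → Set (sphericalUnion cs)), fun τ s hs => ?_⟩
    obtain ⟨w, hw⟩ := (τ 0).carrier_nonempty
    rw [← Finset.card_univ]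
    refine Finset.card_le_card_of_injOn
      (fun σ k => {f : sphericalUnion cs | w * f ∈ (σ k).carrier}) (fun _ _ => Finset.mem_univ _) ?_
    have hcomp : ∀ σ ∈ s, ∀ k, σ k ≤ τ 0 ∨ τ 0 ≤ σ k := by
      intro σ hσ k
      rw [← hs σ hσ]
      rcases le_total k (j.succAbove 0) with hk | hk
      · exact Or.inl (σ.monotone hk)
      · exact Or.inr (σ.monotone hk)
    have hsub : ∀ σ ∈ s, ∀ ρ : Simplex (SphericalCoset cs) (i + 1),
        (∀ k, {f : sphericalUnion cs | w * f ∈ (σ k).carrier} =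
          {f : sphericalUnion cs | w * f ∈ (ρ k).carrier}) →
        ∀ k, (σ k).carrier ⊆ (ρ k).carrier := by
      intro σ hσ ρ h k x hx
      have h1 := (Set.ext_iff.1 (h k)
        ⟨w⁻¹ * x, inv_mul_mem_sphericalUnion (hcomp σ hσ k) hw hx⟩).1
      simp only [Set.mem_ofPred_eq, mul_inv_cancel_left] at h1
      exact h1 hx
    intro σ hσ ρ hρ h
    ext k : 1
    exact carrier_injective cs ((hsub σ hσ ρ (congrFun h) k).antisymm
      (hsub ρ hρ σ (fun k => (congrFun h k).symm) k))

/-- Left translation as an order embedding. -/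
def translateEmbedding (cs : CoxeterSystem M W) (g : W) :
    SphericalCoset cs ↪o SphericalCoset cs where
  toFun c := g • c
  inj' := MulAction.injective g
  map_rel_iff' := smul_le_smul_iff g _ _

instance simplexAction (i : ℕ) : MulAction W (Simplex (SphericalCoset cs) i) where
  smul g σ := σ.trans (translateEmbedding cs g)
  one_smul σ := by
    ext k : 1
    exact one_smul W (σ k)
  mul_smul g h σ := by
    ext k : 1
    exact mul_smul g h (σ k)

theorem simplex_smul_apply (g : W) {i : ℕ} (σ : Simplex (SphericalCoset cs) i) (k : Fin (i + 1)) :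
    (g • σ) k = g • σ k := rfl

theorem face_smul (g : W) (i : ℕ) (σ : Simplex (SphericalCoset cs) (i + 1)) (j : Fin (i + 2)) :
    face (g • σ) j = g • face σ j := rfl

theorem finite_one_mem [Finite B] (cs : CoxeterSystem M W) (i : ℕ) :
    {σ : Simplex (SphericalCoset cs) i | 1 ∈ (σ 0).carrier}.Finite := by
  refine Set.Finite.of_finite_image (f := fun σ k => (σ k).cellType) (Set.toFinite _) ?_
  intro σ hσ ρ hρ h
  ext k : 1
  apply carrier_injective cs
  have hk : (σ k).cellType = (ρ k).cellType := congrFun h k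
  rw [(σ k).carrier_eq_of_mem (σ.monotone (Fin.zero_le k) hσ),
    (ρ k).carrier_eq_of_mem (ρ.monotone (Fin.zero_le k) hρ), hk]

open Classical in
/-- The frame of the square-summable chains of the Davis complex: the simplices whose first vertex
contains `1`, weighted by the size of that vertex. -/
noncomputable def simplexFrame [Finite B] (cs : CoxeterSystem M W) (i : ℕ) :
    ParsevalFrame (permRep W (Simplex (SphericalCoset cs) i)) (Simplex (SphericalCoset cs) i) :=
  weightFrame (fun σ => if 1 ∈ (σ 0).carrier then ((σ 0).carrier.ncard : ℝ)⁻¹ else 0)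
    (finite_one_mem cs i).toFinset
    (fun σ => by split_ifs <;> positivity)
    (fun σ hσ => if_neg fun h => hσ ((finite_one_mem cs i).mem_toFinset.2 h))
    (fun σ => by
      have hfin := (σ 0).finite_carrier
      have h : ∀ g : W, (if 1 ∈ ((g⁻¹ • σ) 0).carrier then
          (((g⁻¹ • σ) 0).carrier.ncard : ℝ)⁻¹ else 0) =
          if g ∈ hfin.toFinset then ((σ 0).carrier.ncard : ℝ)⁻¹ else 0 := by
        intro g
        simp only [simplex_smul_apply, one_mem_inv_smul_iff, hfin.mem_toFinset]
        rw [smul_carrier, Set.ncard_image_of_injective _ (mul_right_injective g⁻¹)]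
      simp only [h]
      have h1 : HasSum (fun g : W => if g ∈ hfin.toFinset then ((σ 0).carrier.ncard : ℝ)⁻¹ else 0)
          (∑ g ∈ hfin.toFinset, if g ∈ hfin.toFinset then ((σ 0).carrier.ncard : ℝ)⁻¹ else 0) :=
        hasSum_sum_of_ne_finset_zero fun g hg => if_neg hg
      rw [Finset.sum_congr rfl fun g hg => if_pos hg, Finset.sum_const, nsmul_eq_mul,
        ← Set.ncard_eq_toFinset_card _ hfin, mul_inv_cancel₀] at h1
      · exact h1
      · exact_mod_cast ((Set.ncard_pos hfin).2 (σ 0).carrier_nonempty).ne')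

end SphericalCoset

/-! ## Chains of ruins -/

/-- The simplices of `Ω(U, T)` which are not in its boundary. -/
def IsRuinSimplex (cs : CoxeterSystem M W) (U T : Set B) (i : ℕ)
    (σ : Simplex (SphericalCoset cs) i) : Prop :=
  T ⊆ (σ (Fin.last i)).cellType ∧ (σ (Fin.last i)).cellType ⊆ U

theorem mem_ruin_diff_iff (cs : CoxeterSystem M W) (U T : Set B) (i : ℕ)
    (σ : Simplex (SphericalCoset cs) i) :
    (σ ∈ (ruin cs U T).simplices i ∧ σ ∉ (ruinBoundary cs U T).simplices i) ↔
      IsRuinSimplex cs U T i σ := by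
  constructor
  · rintro ⟨⟨c, hc, hσ⟩, h⟩
    refine ⟨?_, (SphericalCoset.le_cellType (hσ _)).trans hc.2⟩
    by_contra hT
    exact h ⟨σ (Fin.last i), ⟨⟨c, hc, hσ _⟩, hT⟩, fun j => σ.monotone (Fin.le_last j)⟩
  · rintro ⟨hT, hU⟩
    refine ⟨⟨σ (Fin.last i), ⟨hT, hU⟩, fun j => σ.monotone (Fin.le_last j)⟩, ?_⟩
    rintro ⟨c, ⟨_, hc⟩, hσ⟩
    exact hc (hT.trans (SphericalCoset.le_cellType (hσ _)))

theorem ruinHomologyVanishes_iff [Finite B] (cs : CoxeterSystem M W) (U T : Set B) (i : ℕ) :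
    RuinHomologyVanishes cs U T (i + 1) ↔ ReducedVanishes (IsRuinSimplex cs U T) i := by
  rw [RuinHomologyVanishes, subsingleton_reducedL2Homology_iff]
  have : (fun i σ => σ ∈ (ruin cs U T).simplices i ∧ σ ∉ (ruinBoundary cs U T).simplices i) =
      IsRuinSimplex cs U T := by
    funext i σ
    exact propext (mem_ruin_diff_iff cs U T i σ)
  rw [this]

theorem isRuinSimplex_smul_iff (cs : CoxeterSystem M W) (U T : Set B) (i : ℕ) (g : W)
    (σ : Simplex (SphericalCoset cs) i) :
    IsRuinSimplex cs U T i (g • σ) ↔ IsRuinSimplex cs U T i σ := Iff.rfl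

theorem cellType_face_last_subset {i : ℕ} (σ : Simplex (SphericalCoset cs) (i + 1))
    (j : Fin (i + 2)) :
    (face σ j (Fin.last i)).cellType ⊆ (σ (Fin.last (i + 1))).cellType :=
  SphericalCoset.le_cellType (σ.monotone (Fin.le_last _))

theorem reducedVanishes_of_not_isSpherical [Finite B] {U T : Set B} (hT : ¬ IsSpherical cs T)
    (i : ℕ) : ReducedVanishes (IsRuinSimplex cs U T) i := by
  intro z hz _
  have hz0 : z = 0 := by
    rw [← hz]
    ext σ
    rw [suppProj_apply, if_neg]
    · rfl
    · rintro ⟨h, _⟩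
      have : Finite (parabolic cs (σ (Fin.last (i + 1))).cellType) :=
        (σ (Fin.last (i + 1))).spherical
      have hle : parabolic cs T ≤ parabolic cs (σ (Fin.last (i + 1))).cellType :=
        Subgroup.closure_mono (Set.image_mono h)
      exact hT (Finite.of_injective _ (Subgroup.inclusion_injective hle))
  rw [hz0]
  exact zero_mem _

theorem inf_closure_range_ruin_le [Finite B] (cs : CoxeterSystem M W) (U T U' T' : Set B) (i : ℕ) :
    supportedOn (IsRuinSimplex cs U T (i + 1)) ⊓
        (suppProj (IsRuinSimplex cs U' T' (i + 1)) ∘L boundary (SphericalCoset cs) (i + 1) ∘L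
          suppProj (IsRuinSimplex cs U' T' (i + 2))).range.topologicalClosure ≤
      (supportedOn (IsRuinSimplex cs U T (i + 1)) ⊓
        (suppProj (IsRuinSimplex cs U' T' (i + 1)) ∘L boundary (SphericalCoset cs) (i + 1) ∘L
          suppProj (IsRuinSimplex cs U' T' (i + 2))).range).topologicalClosure := by
  have hp : ∀ U T i, IsEquivariant (permRep W (Simplex (SphericalCoset cs) i))
      (permRep W (Simplex (SphericalCoset cs) i)) (suppProj (IsRuinSimplex cs U T i)) :=
    fun U T i => isEquivariant_suppProj fun g σ => isRuinSimplex_smul_iff cs U T i g σ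
  have hd := isEquivariant_boundary (P := SphericalCoset cs) SphericalCoset.face_smul (i + 1)
  refine (SphericalCoset.simplexFrame cs (i + 2)).inf_closure_range_le
    (SphericalCoset.simplexFrame cs (i + 1)) (fun g x => ?_) (fun g x hx => ?_)
    (isClosed_supportedOn _)
  · simp only [comp_apply]
    rw [hp, hd, hp]
  · rw [mem_supportedOn] at hx ⊢
    rw [hp, hx]

theorem RuinHomologyVanishes.of_insert [Finite B] {V : Set B} {s t : B} (hs : s ∉ V)
    {i : ℕ} (hC : RuinHomologyVanishes cs (insert s V) {t} (i + 1))
    (hD : IsSpherical cs {s, t} → RuinHomologyVanishes cs (insert s V) {s, t} (i + 2)) :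
    RuinHomologyVanishes cs V {t} (i + 1) := by
  rw [ruinHomologyVanishes_iff] at hC ⊢
  refine ReducedVanishes.of_disjoint_union (D := IsRuinSimplex cs (insert s V) {s, t})
    (fun i σ => ?_) (fun i σ hA hD => ?_) (fun i σ j hA hD => ?_) (fun i σ j k hD hA => ?_)
    (inf_closure_range_ruin_le cs V {t} (insert s V) {t} i) hC ?_
  · simp only [IsRuinSimplex, Set.insert_subset_iff, Set.singleton_subset_iff]
    constructor
    · rintro ⟨h1, h2⟩
      by_cases h : s ∈ (σ (Fin.last i)).cellType
      · exact Or.inr ⟨⟨h, h1⟩, h2⟩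
      · exact Or.inl ⟨h1, (Set.subset_insert_iff_of_notMem h).1 h2⟩
    · rintro (⟨h1, h2⟩ | ⟨⟨_, h1⟩, h2⟩)
      · exact ⟨h1, h2.trans (Set.subset_insert s V)⟩
      · exact ⟨h1, h2⟩
  · exact hs (hA.2 (hD.1 (Set.mem_insert s _)))
  · exact hs (hA.2 (cellType_face_last_subset σ j (hD.1 (Set.mem_insert s _))))
  · exact ⟨hA.1.trans (cellType_face_last_subset _ k), (cellType_face_last_subset σ j).trans hD.2⟩
  · by_cases h : IsSpherical cs {s, t}
    · exact (ruinHomologyVanishes_iff cs _ _ (i + 1)).1 (hD h)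
    · exact reducedVanishes_of_not_isSpherical h (i + 1)

end Davis

theorem mainTheorem4 (n : ℕ) (hII : Davis.ConjectureII.{u, v} n)
    (hTR : Davis.ConjectureTR.{u, v} n) : Davis.ConjectureV.{u, v} n := by
  intro B _ W _ M cs hL V t ht i hi
  obtain ⟨i, rfl⟩ : ∃ k, i = k + 1 := by
    refine Nat.exists_eq_succ_of_ne_zero ?_
    rintro rfl
    have : (0 : ℝ) ≤ n := n.cast_nonneg
    push_cast at hi
    linarith
  induction hk : (Vᶜ).ncard generalizing V with
  | zero =>
    have hV : V = Set.univ := by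
      rwa [Set.ncard_eq_zero, Set.compl_empty_iff] at hk
    rw [hV]
    exact hII B W M cs hL t _ hi
  | succ k ih =>
    obtain ⟨s, hs⟩ : (Vᶜ).Nonempty := Set.nonempty_of_ncard_ne_zero (by omega)
    refine Davis.RuinHomologyVanishes.of_insert hs (ih (insert s V) (Or.inr ht) ?_)
      fun hsph => ?_
    · have h : (insert s V)ᶜ = Vᶜ \ {s} := by
        ext x
        simp only [Set.mem_compl_iff, Set.mem_insert_iff, Set.mem_sdiff, Set.mem_singleton_iff]
        tauto
      rw [h, Set.ncard_sdiff_singleton_of_mem hs, hk]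
      rfl
    · have hst : s ≠ t := fun h => hs (h ▸ ht)
      refine hTR B W M cs hL (insert s V) {s, t} ?_ hsph (Set.ncard_pair hst) _ ?_
      · rintro x (rfl | rfl)
        · exact Set.mem_insert x V
        · exact Or.inr ht
      · push_cast at hi ⊢
        linarith
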